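/- Let $g\ge 2$ and let $\Gamma$ be a group freely generated by $g_1,\dots,g_g$ (for instance a Schottky group of rank $g$ in $\mathrm{PSL}(2,\mathbb C)$ with a choice of free generators); put $g_{i+g}:=g_i^{-1}$. Call a juxtaposition $aa'$ of two letters from $\{g_1,\dots,g_{2g}\}$ admissible if $a'\ne a^{-1}$. Let $\mathcal S$ be the space of doubly infinite admissible sequences $x=(x_k)_{k\in\mathbb Z}$ (i.e. $x_{k+1}\neq x_k^{-1}$ for all $k$), with the topology induced by the product topology, let $T$ be the shift $(Tx)_k=x_{k+1}$, let $$\mathcal S_T=\mathcal S\times[0,1]\,/\,(x,0)\sim(Tx,1)$$ be its mapping torus, and let $H_1(\mathcal S_T,\mathbb Z)$ be its first singular homology group. If $x\in\mathcal S$ is periodic of minimal period $n$, let $c(x)\in H_1(\mathcal S_T,\mathbb Z)$ be the class of the closed orbit of $x$ under the flow, i.e. of the singular cycle $\sum_{k=0}^{n-1}\big(t\mapsto[T^kx,t]\big)$. A word $a_0\dots a_N$ ($N\ge 0$) is cyclically admissible if it is admissible and $a_Na_0$ is also admissible. Let $\mathcal K_N$ be the free abelian group generated by the cyclically admissible words $a_0\dots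 a_N$. Then: 1. $\mathcal K_N$ has finite rank $$\mathrm{rank}\,\mathcal K_N=\begin{cases}(2g-1)^{N+1}+1 & N\text{ even},\\ (2g-1)^{N+1}+(2g-1)& N\text{ odd}.\end{cases}$$ 2. $H_1(\mathcal S_T,\mathbb Z)=\varinjlim_N\mathcal K_N$: there are homomorphisms $\mathcal K_N\to\mathcal K_M$ for $(N+1)\mid(M+1)$ which form a directed system, and an isomorphism of its direct limit with $H_1(\mathcal S_T,\mathbb Z)$ which sends the element given by a word $a_0\dots a_N$ to $c(x)$, where $x$ is the periodic sequence $\overline{a_0\dots a_N}$. 3. $H_1(\mathcal S_T,\mathbb Z)$ is the union of an increasing sequence of subgroups $F_0\subset F_1\subset\cdots$ with $F_N\cong\mathcal K_N$ for all $N\ge0$. It is also the union of an increasing sequence of free abelian subgroups $F'_0\subset F'_1\subset\cdots$ with $\mathrm{rank}\,F'_N=(2g-1)^N+1$ for $N$ even and $\mathrm{rank}\,F'_N=(2g-1)^N+(2g-1)$ for $N$ odd. 4. $H_1(\mathcal S_T,\mathbb Z)=\bigoplus_{N\ge1}\mathcal R_N$, where $\mathcal R_N$ is the subgroup generated by the classes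 $c(x)$ of the closed orbits of minimal period $N$. It is free abelian of finite rank $R_N$, with $R_1=2g$, $R_2=2g(g-1)$ and $$R_N=\frac1N\sum_{d\mid N}\mu(d)\,(2g-1)^{N/d}\qquad(N>2),$$ with $\mu$ the Möbius function. There is also a decomposition $H_1(\mathcal S_T,\mathbb Z)=\bigoplus_{N\ge1}\mathcal R'_N$ into free abelian subgroups of finite ranks $R'_1=2g$ and $R'_N=\frac1N\sum_{d\mid N}\mu(d)(2g-1)^{N/d}$ for all $N>1$. 5. $H_1(\mathcal S_T,\mathbb Z)$ is free abelian on countably infinitely many generators. -/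

import Mathlib

open CategoryTheory

noncomputable section

namespace SchottkyShift

variable {g : ℕ} {Γ : Type} [Group Γ]

/-- The alphabet `{g₁, …, g_{2g}}`: the free generators of `Γ` and their inverses. -/
def Letter (b : FreeGroupBasis (Fin g) Γ) : Type :=
  {γ : Γ // ∃ i : Fin g, γ = b i ∨ γ = (b i)⁻¹}

/-- The alphabet is a finite discrete space. -/
instance (b : FreeGroupBasis (Fin g) Γ) : TopologicalSpace (Letter b) := ⊥

instance (b : FreeGroupBasis (Fin g) Γ) : DiscreteTopology (Letter b) := ⟨rfl⟩

/-- The juxtaposition `a a'` of two letters is admissible if there is no cancellation. -/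
def Admissible {b : FreeGroupBasis (Fin g) Γ} (a a' : Letter b) : Prop :=
  a'.1 ≠ a.1⁻¹

/-- The space `𝒮` of doubly infinite admissible sequences. -/
def Seq (b : FreeGroupBasis (Fin g) Γ) : Type :=
  {x : ℤ → Letter b // ∀ k, Admissible (x k) (x (k + 1))}

/-- `𝒮` carries the subspace topology of the product topology on `ℤ → Letter b` (generated by the
cylinder sets); it is the usual topology of a subshift of finite type. -/
instance (b : FreeGroupBasis (Fin g) Γ) : TopologicalSpace (Seq b) :=
  inferInstanceAs (TopologicalSpace {x : ℤ → Letter b // ∀ k, Admissible (x k) (x (k + 1))})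

/-- The two-sided shift `(T x)ₖ = xₖ₊₁`. -/
def shift (b : FreeGroupBasis (Fin g) Γ) (x : Seq b) : Seq b :=
  ⟨fun k => x.1 (k + 1), fun k => x.2 (k + 1)⟩

/-- The gluing `(x, 0) ∼ (T x, 1)`. -/
inductive Glue (b : FreeGroupBasis (Fin g) Γ) : Seq b × unitInterval → Seq b × unitInterval → Prop
  | glue (x : Seq b) : Glue b (x, 0) (shift b x, 1)

/-- The mapping torus `𝒮_T = 𝒮 × [0,1] / (x, 0) ∼ (T x, 1)`, with the quotient topology. -/
def MappingTorus (b : FreeGroupBasis (Fin g) Γ) : Type := Quot (Glue b)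

instance (b : FreeGroupBasis (Fin g) Γ) : TopologicalSpace (MappingTorus b) :=
  inferInstanceAs (TopologicalSpace (Quot (Glue b)))

/-- The singular homology group `H₁(𝒮_T, ℤ)`. -/
abbrev H1 (b : FreeGroupBasis (Fin g) Γ) : ModuleCat.{0} ℤ :=
  ((AlgebraicTopology.singularHomologyFunctor (ModuleCat.{0} ℤ) 1).obj (ModuleCat.of ℤ ℤ)).obj
    (TopCat.of (MappingTorus b))

/-- The flow segment `t ↦ [x, t]`, `0 ≤ t ≤ 1`, as a map from the unit interval to `𝒮_T`. -/
def flowPath (b : FreeGroupBasis (Fin g) Γ) (x : Seq b) :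
    TopCat.I ⟶ TopCat.of (MappingTorus b) :=
  TopCat.ofHom
    { toFun := fun t => Quot.mk _ (x, t.down)
      continuous_toFun := continuous_quot_mk.comp (by fun_prop) }

/-- The singular simplicial set of `𝒮_T`. -/
abbrev Sing (b : FreeGroupBasis (Fin g) Γ) : SSet.{0} :=
  TopCat.toSSet.obj (TopCat.of (MappingTorus b))

/-- The flow segment as a singular `1`-simplex of `𝒮_T`. -/
def flowSimplex (b : FreeGroupBasis (Fin g) Γ) (x : Seq b) :
    (Sing b).obj (Opposite.op (SimplexCategory.mk 1)) :=
  TopCat.toSSetObj₁Equiv.symm (flowPath b x)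

/-- The singular `1`-chain `∑_{k < n} (t ↦ [Tᵏ x, t])`, as a homomorphism `ℤ → C₁(𝒮_T, ℤ)`. -/
def orbitChain (b : FreeGroupBasis (Fin g) Γ) (x : Seq b) (n : ℕ) :
    ModuleCat.of ℤ ℤ ⟶ ((Sing b).chainComplex (ModuleCat.of ℤ ℤ)).X 1 :=
  ∑ k ∈ Finset.range n, (Sing b).ιChainComplex (flowSimplex b ((shift b)^[k] x))

lemma glue_zero (b : FreeGroupBasis (Fin g) Γ) (x : Seq b) :
    (Sing b).δ 1 (flowSimplex b x) = (Sing b).δ 0 (flowSimplex b (shift b x)) := by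
  rw [flowSimplex, flowSimplex, TopCat.δ_one_toSSetObj₁Equiv.symm,
    TopCat.δ_zero_toSSetObj₁Equiv.symm]
  exact congrArg _ (Quot.sound (Glue.glue x))

lemma orbitChain_d (b : FreeGroupBasis (Fin g) Γ) (x : Seq b) (n : ℕ)
    (h : (shift b)^[n] x = x) :
    orbitChain b x n ≫ ((Sing b).chainComplex (ModuleCat.of ℤ ℤ)).d 1 0 = 0 := by
  have key : ∀ y, (Sing b).ιChainComplex (R := ModuleCat.of ℤ ℤ) (flowSimplex b y) ≫
      ((Sing b).chainComplex (ModuleCat.of ℤ ℤ)).d 1 0 =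
      (Sing b).ιChainComplex ((Sing b).δ 0 (flowSimplex b y)) -
      (Sing b).ιChainComplex ((Sing b).δ 0 (flowSimplex b (shift b y))) := by
    intro y
    rw [SSet.ιChainComplex_d, Fin.sum_univ_two, ← glue_zero]
    simp [sub_eq_add_neg]
  rw [orbitChain, Preadditive.sum_comp]
  simp only [key, ← Function.iterate_succ_apply' (shift b)]
  rw [Finset.sum_range_sub', h]
  simp

/-- The homology class of the closed orbit of a periodic point `x` of the shift under the flow:
the class of the cycle `∑_{k < n} (t ↦ [Tᵏ x, t])`, where `n` is the minimal period of `x`.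
(If `x` is not periodic, then `n = 0` and the class is `0`.) -/
def orbitClass (b : FreeGroupBasis (Fin g) Γ) (x : Seq b) : H1 b :=
  (((Sing b).chainComplex (ModuleCat.of ℤ ℤ)).liftCycles
      (orbitChain b x (Function.minimalPeriod (shift b) x)) 0 (by simp)
      (orbitChain_d b x _ (Function.iterate_minimalPeriod)) ≫
    ((Sing b).chainComplex (ModuleCat.of ℤ ℤ)).homologyπ 1).hom (1 : ℤ)

/-- The cyclically admissible words `a₀ … a_N`: admissible words such that `a_N a₀` is also
admissible. -/
def CyclicWord (b : FreeGroupBasis (Fin g) Γ) (N : ℕ) : Type :=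
  {a : Fin (N + 1) → Letter b //
    (∀ i : Fin N, Admissible (a i.castSucc) (a i.succ)) ∧ Admissible (a (Fin.last N)) (a 0)}

/-- `𝒦_N`: the free abelian group generated by the cyclically admissible words `a₀ … a_N`. -/
abbrev K (b : FreeGroupBasis (Fin g) Γ) (N : ℕ) : Type := CyclicWord b N →₀ ℤ

/-- `ℛ_N`: the subgroup of `H₁(𝒮_T, ℤ)` generated by the closed orbits of minimal period `N`. -/
def R (b : FreeGroupBasis (Fin g) Γ) (N : ℕ) : Submodule ℤ (H1 b) :=
  Submodule.span ℤ {c | ∃ x : Seq b, Function.minimalPeriod (shift b) x = N ∧ orbitClass b x = c}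

/-- A copy of the natural numbers, ordered by `N ≤ M` iff the word length `N + 1` divides `M + 1`:
then a word `a₀ … a_N` can be repeated to a word of length `M + 1`. -/
structure WordIndex : Type where
  val : ℕ

instance : DecidableEq WordIndex := Classical.decEq _

instance : Preorder WordIndex where
  le N M := N.val + 1 ∣ M.val + 1
  le_refl _ := dvd_rfl
  le_trans _ _ _ := dvd_trans

end SchottkyShift

end

noncomputable section

namespace SchottkyShift

variable {g : ℕ} {Γ : Type} [Group Γ] {b : FreeGroupBasis (Fin g) Γ}

/-! ### The powers of the shift -/

/-! The group ℤ acts on 𝒮 × ℝ by `(x, s) ↦ (Tᵐ x, s + m)`, and `cover` is the covering of 𝒮_T by the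
quotient map of this action. Simplices are simply connected, so singular simplices of 𝒮_T lift;
since 𝒮 is totally disconnected, each lift stays in one line `{x} × ℝ`. Singular chains of 𝒮_T are
thus sums of chains in flow lines.

For a path in a flow line, record with sign the points of 𝒮 at which it crosses the base. This
`crossing` vanishes on boundaries, and on cycles it is shift-invariant (`crossing_sub_mapDomain`).
Conversely, inside its contractible line, a path can be replaced modulo boundaries by the flow
segments it crosses, corrected at both ends (`toModBoundaries_eq`); hence crossings determine a
homology class. So H₁ embeds into the finitely supported shift-invariant functions 𝒮 → ℤ. Finite
support confines these to periodic points, where the indicators of finite orbits form a basis, and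
these indicators are the crossings of the closed orbits. The closed orbits therefore form a basis of
H₁ (`orbitBasis`).

The rest is counting. Points fixed by `Tᴺ⁺¹` are cyclically admissible words, whose number is the
trace of a power of the transition matrix; Möbius inversion gives the number of orbits of each
period. In the direct limit, the transition maps between distinct indices pass through H₁ and pick
one word per orbit, which identifies the rotations of a word. The filtrations and the second
decomposition prescribe only ranks and come from cutting up a countable basis. -/

/-- The `m`-th power of the shift, for an integer `m`. -/
def translate (m : ℤ) (x : Seq b) : Seq b :=
  ⟨fun k => x.1 (k + m), fun k => by simpa only [add_right_comm] using x.2 (k + m)⟩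

@[ext]
lemma Seq.ext {x y : Seq b} (h : ∀ k, x.1 k = y.1 k) : x = y := Subtype.ext (funext h)

@[simp]
lemma translate_apply (m : ℤ) (x : Seq b) (k : ℤ) : (translate m x).1 k = x.1 (k + m) := rfl

@[simp]
lemma translate_zero (x : Seq b) : translate 0 x = x := by ext k; simp

@[simp]
lemma translate_translate (m n : ℤ) (x : Seq b) :
    translate m (translate n x) = translate (m + n) x := by
  ext k; simp [add_assoc]

lemma shift_eq_translate (x : Seq b) : shift b x = translate 1 x := rfl

lemma shift_iterate (n : ℕ) (x : Seq b) : (shift b)^[n] x = translate n x := by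
  induction n with
  | zero => simp
  | succ n ih =>
    rw [Function.iterate_succ_apply', ih, shift_eq_translate, translate_translate]
    push_cast
    rw [add_comm]

lemma translate_injective (m : ℤ) : Function.Injective (translate (b := b) m) := fun x y h => by
  simpa using congrArg (translate (-m)) h

/-- The minimal period of a point under the shift. -/
abbrev period (x : Seq b) : ℕ := Function.minimalPeriod (shift b) x

lemma continuous_translate (m : ℤ) : Continuous (translate (b := b) m) :=
  continuous_induced_rng.2
    (continuous_pi fun k => (continuous_apply (k + m)).comp continuous_induced_dom)

instance : TotallyDisconnectedSpace (Seq b) :=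
  inferInstanceAs (TotallyDisconnectedSpace
    {x : ℤ → Letter b // ∀ k, Admissible (x k) (x (k + 1))})

/-! ### The covering of the mapping torus by `𝒮 × ℝ` -/

/-- The deck transformations of the covering `𝒮 × ℝ → 𝒮_T`. -/
instance : AddAction ℤ (Seq b × ℝ) where
  vadd m p := (translate m p.1, p.2 + m)
  zero_vadd p := Prod.ext (translate_zero _) (by simp [HVAdd.hVAdd])
  add_vadd m n p := Prod.ext (by simp [HVAdd.hVAdd])
    (by simp [HVAdd.hVAdd, add_left_comm, add_comm])

lemma vadd_def (m : ℤ) (p : Seq b × ℝ) : m +ᵥ p = (translate m p.1, p.2 + m) := rfl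

/-- The point `[x, s]` of the mapping torus for `s : ℝ`, obtained by following the flow. -/
def cover (p : Seq b × ℝ) : MappingTorus b :=
  Quot.mk _ (translate (-⌊p.2⌋) p.1, ⟨Int.fract p.2, Int.fract_nonneg _, (Int.fract_lt_one _).le⟩)

lemma cover_vadd (m : ℤ) (p : Seq b × ℝ) : cover (m +ᵥ p) = cover p := by
  simp only [cover, vadd_def]
  congr 2
  · simp
  · simp

lemma cover_translate (m : ℤ) (x : Seq b) (s : ℝ) : cover (translate m x, s + m) = cover (x, s) :=
  cover_vadd m (x, s)

/-- At the right endpoint the floor jumps, and the gluing relation makes the two formulas agree. A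
formula on closed strips allows continuity to be checked on a locally finite closed cover. -/
lemma cover_of_mem (n : ℤ) (p : Seq b × ℝ) (h : p.2 ∈ Set.Icc (n : ℝ) (n + 1)) :
    cover p = Quot.mk _ (translate (-n) p.1, Set.projIcc 0 1 zero_le_one (p.2 - n)) := by
  obtain ⟨x, s⟩ := p
  rcases h.2.lt_or_eq with h' | h'
  · have hn : ⌊s⌋ = n := Int.floor_eq_iff.2 ⟨h.1, h'⟩
    simp only [cover, hn]
    congr 2
    rw [Set.projIcc_of_mem zero_le_one (x := s - n) ⟨by linarith [h.1], by linarith [h.2]⟩]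
    ext
    simp [Int.fract, hn]
  · dsimp only at h'
    subst h'
    have hn : ⌊(n : ℝ) + 1⌋ = n + 1 := by exact_mod_cast Int.floor_intCast (R := ℝ) (n + 1)
    have e : translate (-n) x = shift b (translate (-(n + 1)) x) := by
      rw [shift_eq_translate, translate_translate]; congr 1; ring
    simp only [cover, hn, e, add_sub_cancel_left, Set.projIcc_right]
    refine Eq.trans ?_ (Quot.sound (Glue.glue (translate (-(n + 1)) x)))
    congr 2
    ext
    simp [Int.fract, hn]

lemma cover_unitInterval (x : Seq b) (t : unitInterval) :
    cover (x, (t : ℝ)) = Quot.mk _ (x, t) := by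
  rw [cover_of_mem 0 (x, (t : ℝ)) ⟨by simpa using t.2.1, by simpa using t.2.2⟩]
  simp only [neg_zero, translate_zero, Int.cast_zero, sub_zero, Set.projIcc_val]
  rfl

lemma continuous_cover : Continuous (cover (b := b)) := by
  have hf : LocallyFinite fun n : ℤ => Set.Icc (n : ℝ) (n + 1) :=
    locallyFinite_Icc_of_tendsto tendsto_intCast_atTop_atTop
      (Filter.tendsto_atBot_add_const_right _ _ (tendsto_intCast_atBot_iff.2 Filter.tendsto_id))
  refine (hf.preimage_continuous (g := fun p : Seq b × ℝ => p.2) continuous_snd).continuous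
    ?_ (fun n => isClosed_Icc.preimage continuous_snd) fun n => ?_
  · refine Set.eq_univ_of_forall fun p => Set.mem_iUnion.2 ⟨⌊p.2⌋, ?_⟩
    exact ⟨Int.floor_le _, (Int.lt_floor_add_one _).le⟩
  · have h := continuous_translate (b := b) (-n)
    have : Continuous fun p : Seq b × ℝ =>
        (translate (-n) p.1, Set.projIcc 0 1 zero_le_one (p.2 - n)) := by
      refine Continuous.prodMk (by fun_prop) (continuous_projIcc.comp (by fun_prop))
    exact (continuous_quot_mk.comp this).continuousOn.congr fun p hp => cover_of_mem n p hp

/-- Restricted to 𝒮 × [0,1], the map is the defining quotient map of the mapping torus. -/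
lemma isQuotientMap_cover : Topology.IsQuotientMap (cover (b := b)) := by
  have hι : Continuous fun p : Seq b × unitInterval => (p.1, (p.2 : ℝ)) := by fun_prop
  refine Topology.IsQuotientMap.of_comp hι continuous_cover ?_
  have e : cover ∘ (fun p : Seq b × unitInterval => (p.1, (p.2 : ℝ))) = Quot.mk (Glue b) :=
    funext fun p => cover_unitInterval p.1 p.2
  rw [e]
  exact isQuotientMap_quot_mk

/-- The orbit of a point of the mapping torus in `𝒮 × ℝ`. -/
def toOrbit : MappingTorus b → Quotient (AddAction.orbitRel ℤ (Seq b × ℝ)) :=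
  Quot.lift (fun p => Quotient.mk _ (p.1, (p.2 : ℝ))) fun p q h => by
    obtain ⟨x⟩ := h
    refine Quotient.sound ⟨-1, ?_⟩
    simp [vadd_def, shift_eq_translate]

/-- Shows that fibres of `cover` lie in single orbits, without analysing the equivalence relation
generated by `Glue`. -/
lemma toOrbit_cover (p : Seq b × ℝ) : toOrbit (cover p) = Quotient.mk _ p :=
  Quotient.sound ⟨-⌊p.2⌋, by
    simp only [vadd_def]
    refine Prod.ext rfl ?_
    simp [Int.fract, sub_eq_add_neg]⟩

lemma isAddQuotientCoveringMap_cover : IsAddQuotientCoveringMap (cover (b := b)) ℤ where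
  __ := isQuotientMap_cover
  continuous_const_vadd m := by
    have := continuous_translate (b := b) m
    simp only [vadd_def]
    fun_prop
  apply_eq_iff_mem_orbit {p q} := by
    refine ⟨fun h => ?_, ?_⟩
    · have := congrArg toOrbit h
      rw [toOrbit_cover, toOrbit_cover] at this
      exact Quotient.exact this
    · rintro ⟨m, rfl⟩
      exact cover_vadd m q
  disjoint p := by
    -- A deck transformation moves the real coordinate by an integer, so an open strip of width 1
    -- meets only its own translate by 0.
    refine ⟨{q | |q.2 - p.2| < 1 / 2}, ?_, ?_⟩
    · refine IsOpen.mem_nhds (isOpen_lt (by fun_prop) (by fun_prop)) (by simp)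
    · rintro m ⟨_, ⟨q, hq, rfl⟩, hq'⟩
      simp only [vadd_def, Set.mem_ofPred_eq] at hq hq'
      rw [abs_lt] at hq hq'
      have h1 : (m : ℝ) < 1 := by linarith
      have h2 : (-1 : ℝ) < m := by linarith
      have h1' : m < 1 := by exact_mod_cast h1
      have h2' : -1 < m := by exact_mod_cast h2
      omega

lemma isCoveringMap_cover : IsCoveringMap (cover (b := b)) :=
  isAddQuotientCoveringMap_cover.isCoveringMap

lemma cover_eq_cover {x y : Seq b} {s t : ℝ} (h : cover (x, s) = cover (y, t)) :
    ∃ m : ℤ, translate m y = x ∧ t + m = s := by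
  obtain ⟨m, hm⟩ := isAddQuotientCoveringMap_cover.apply_eq_iff_mem_orbit.1 h
  exact ⟨m, congrArg Prod.fst hm, congrArg Prod.snd hm⟩

/-- Maps from a simply connected space to the mapping torus lift to one sheet. -/
lemma exists_lift {A : Type} [TopologicalSpace A] [SimplyConnectedSpace A]
    [LocallyPathConnectedSpace A] (f : C(A, MappingTorus b)) :
    ∃ (x : Seq b) (s : C(A, ℝ)), ∀ u, f u = cover (x, s u) := by
  obtain ⟨u₀⟩ : Nonempty A := inferInstance
  obtain ⟨e, he⟩ := isQuotientMap_cover.surjective (f u₀)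
  obtain ⟨F, ⟨-, hF⟩, -⟩ := isCoveringMap_cover.existsUnique_continuousMap_lifts f u₀ e he
  -- The 𝒮-coordinate of the lift has connected image in a totally disconnected space.
  have hc : ∀ u, (F u).1 = (F u₀).1 := fun u =>
    (isPreconnected_univ.image (fun u => (F u).1) (by fun_prop)).subsingleton
      ⟨u, trivial, rfl⟩ ⟨u₀, trivial, rfl⟩
  refine ⟨(F u₀).1, ⟨fun u => (F u).2, by fun_prop⟩, fun u => ?_⟩
  rw [← hF, Function.comp_apply, ← hc u]
  rfl

/-- A deck transformation matches the two lifts at `u₀`; lifts from a connected space that agree at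
a point agree everywhere. -/
lemma lift_unique {A : Type} [TopologicalSpace A] [PreconnectedSpace A] {x y : Seq b}
    {s t : C(A, ℝ)} (h : ∀ u, cover (x, s u) = cover (y, t u)) (u₀ : A) :
    ∃ m : ℤ, translate m y = x ∧ ∀ u, t u + m = s u := by
  obtain ⟨m, hm, hm'⟩ := cover_eq_cover (h u₀)
  refine ⟨m, hm, fun u => ?_⟩
  have := isCoveringMap_cover.eq_of_comp_eq (g₁ := fun u => (x, s u))
    (g₂ := fun u => (translate m y, t u + m)) (by fun_prop) (by fun_prop)
    (funext fun u => by simp only [Function.comp_apply, cover_translate, h]) u₀ (by simp [hm, hm'])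
  exact (congrArg Prod.snd (congrFun this u)).symm

section Homology

open Simplicial

/-! ### Indefinite sums over the integers -/

section IntSum

variable {A B : Type*} [AddCommGroup A] [AddCommGroup B]

/-- The oriented sum of `w k` over `0 ≤ k < m`, for an integer `m`. -/
def intSum (w : ℤ → A) (m : ℤ) : A :=
  ∑ k ∈ Finset.Ico 0 m, w k - ∑ k ∈ Finset.Ico m 0, w k

@[simp]
lemma intSum_zero (w : ℤ → A) : intSum w 0 = 0 := by simp [intSum]

lemma intSum_succ (w : ℤ → A) (m : ℤ) : intSum w (m + 1) = intSum w m + w m := by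
  rcases le_or_gt 0 m with h | h
  · have e : Finset.Ico 0 (m + 1) = insert m (Finset.Ico 0 m) := by
      ext k; simp only [Finset.mem_Ico, Finset.mem_insert]; omega
    rw [intSum, intSum, e, Finset.sum_insert (by simp), Finset.Ico_eq_empty (a := m) (by omega),
      Finset.Ico_eq_empty (a := m + 1) (by omega)]
    abel
  · have e : Finset.Ico m 0 = insert m (Finset.Ico (m + 1) 0) := by
      ext k; simp only [Finset.mem_Ico, Finset.mem_insert]; omega
    rw [intSum, intSum, e, Finset.sum_insert (by simp), Finset.Ico_eq_empty (b := m) (by omega),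
      Finset.Ico_eq_empty (b := m + 1) (by omega)]
    abel

lemma map_intSum (f : A →+ B) (w : ℤ → A) (m : ℤ) :
    f (intSum w m) = intSum (fun k => f (w k)) m := by
  simp [intSum]

lemma sub_eq_sub_of_increments {f h : ℤ → A} (H : ∀ n, f (n + 1) - f n = h (n + 1) - h n)
    (m n : ℤ) : f m - f n = h m - h n := by
  have key : ∀ k, f k - h k = f 0 - h 0 := fun k => by
    induction k with
    | zero => rfl
    | succ k ih =>
      rw [← ih]; have := H k
      rw [sub_eq_sub_iff_add_eq_add] at this ⊢
      exact this.trans (add_comm _ _)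
    | pred k ih =>
      rw [← ih]; have := H (-k - 1)
      rw [sub_add_cancel, sub_eq_sub_iff_add_eq_add] at this
      rw [sub_eq_sub_iff_add_eq_add]
      exact (add_comm _ _).trans this.symm
  have := (key m).trans (key n).symm
  rw [sub_eq_sub_iff_add_eq_add] at this ⊢
  rw [this]; abel

lemma intSum_sub_intSum {w : ℤ → A} {f : ℤ → A} (H : ∀ n, f (n + 1) - f n = w n) (m n : ℤ) :
    intSum w m - intSum w n = f m - f n :=
  sub_eq_sub_of_increments (fun k => by rw [H, intSum_succ, add_sub_cancel_left]) m n

lemma intSum_shift (w : ℤ → A) (k m n : ℤ) :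
    intSum (fun i => w (i - k)) (m + k) - intSum (fun i => w (i - k)) (n + k) =
      intSum w m - intSum w n :=
  (intSum_sub_intSum (f := fun i => intSum (fun i => w (i - k)) (i + k)) (fun i => by
    rw [add_right_comm, intSum_succ, add_sub_cancel_left, add_sub_cancel_right]) m n).symm

end IntSum

/-! ### Simplicial chains with integral coefficients -/

section Chains

/-- The generator of the group of chains given by a simplex. -/
def cell {X : SSet.{0}} {n : ℕ} (σ : X _⦋n⦌) : (X.chainComplex (ModuleCat.of ℤ ℤ)).X n :=
  (X.ιChainComplex (R := ModuleCat.of ℤ ℤ) σ).hom (1 : ℤ)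

variable {X Y : SSet.{0}} {n : ℕ}

/-- The homomorphism on the group of chains with given values on the simplices. -/
def chainLift {T : Type} [AddCommGroup T] {hT : Module ℤ T} (f : X _⦋n⦌ → T) :
    (X.chainComplex (ModuleCat.of ℤ ℤ)).X n →ₗ[ℤ] T :=
  (Limits.Cofan.IsColimit.desc (X.isColimitChainComplexXCofan (ModuleCat.of ℤ ℤ) n)
    fun σ => ModuleCat.ofHom (LinearMap.toSpanSingleton ℤ T (f σ))).hom

@[simp]
lemma chainLift_cell {T : Type} [AddCommGroup T] {hT : Module ℤ T} (f : X _⦋n⦌ → T) (σ : X _⦋n⦌) :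
    chainLift (hT := hT) f (cell σ) = f σ := by
  have h := Limits.Cofan.IsColimit.fac (X.isColimitChainComplexXCofan (ModuleCat.of ℤ ℤ) n)
    (fun σ => ModuleCat.ofHom (LinearMap.toSpanSingleton ℤ T (f σ))) σ
  have := congrArg (fun φ => φ.hom (1 : ℤ)) h
  -- The action of ℤ given by `hT` and the one coming from the group structure are only
  -- propositionally equal.
  exact this.trans ((int_smul_eq_zsmul _ _ _).trans (one_zsmul _))

lemma chain_ext {T : Type} [AddCommGroup T] {hT : Module ℤ T}
    {f h : (X.chainComplex (ModuleCat.of ℤ ℤ)).X n →ₗ[ℤ] T}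
    (H : ∀ σ : X _⦋n⦌, f (cell σ) = h (cell σ)) : f = h := by
  have : ModuleCat.ofHom f = ModuleCat.ofHom h := by
    refine SSet.chainComplex_hom_ext fun σ => ?_
    ext
    exact H σ
  exact congrArg ModuleCat.Hom.hom this

lemma d_cell (σ : X _⦋n + 1⦌) :
    ((X.chainComplex (ModuleCat.of ℤ ℤ)).d (n + 1) n).hom (cell σ) =
      ∑ i : Fin (n + 2), (-1) ^ i.val • cell (X.δ i σ) := by
  have := congrArg (fun φ => φ.hom (1 : ℤ)) (X.ιChainComplex_d (R := ModuleCat.of ℤ ℤ) σ)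
  refine this.trans ?_
  simp [cell]

lemma chainComplexMap_cell (f : X ⟶ Y) (σ : X _⦋n⦌) :
    ((SSet.chainComplexMap f (ModuleCat.of ℤ ℤ)).f n).hom (cell σ) = cell (f.app _ σ) :=
  congrArg (fun φ : ModuleCat.of ℤ ℤ ⟶ _ => φ.hom (1 : ℤ))
    (SSet.ι_chainComplexMap_f X Y f (ModuleCat.of ℤ ℤ) σ)

/-- Up to homotopy the identity factors through a point, whose first homology vanishes; so the
identity of H₁ is zero. -/
lemma isZero_homology_one_of_contractible (Z : TopCat.{0}) [ContractibleSpace Z] :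
    Limits.IsZero (((TopCat.toSSet.obj Z).chainComplex (ModuleCat.of ℤ ℤ)).homology 1) := by
  obtain ⟨z, ⟨H⟩⟩ := id_nullhomotopic Z
  let P := TopCat.of PUnit.{1}
  let p : Z ⟶ P := TopCat.ofHom ⟨fun _ => PUnit.unit, by fun_prop⟩
  let q : P ⟶ Z := TopCat.ofHom ⟨fun _ => z, by fun_prop⟩
  have H' : TopCat.Homotopy (𝟙 Z) (p ≫ q) := H
  have h := H'.congr_homologyMap_singularChainComplexFunctor (ModuleCat.of ℤ ℤ) 1
  rw [CategoryTheory.Functor.map_id, HomologicalComplex.homologyMap_id,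
    CategoryTheory.Functor.map_comp, HomologicalComplex.homologyMap_comp] at h
  rw [Limits.IsZero.iff_id_eq_zero]
  refine h.trans ?_
  have hz := AlgebraicTopology.isZero_singularHomologyFunctor_of_totallyDisconnectedSpace
    (ModuleCat.{0} ℤ) 1 (ModuleCat.of ℤ ℤ) P one_ne_zero
  rw [Limits.IsZero.eq_zero_of_tgt hz (HomologicalComplex.homologyMap
    (((AlgebraicTopology.singularChainComplexFunctor (ModuleCat.{0} ℤ)).obj
      (ModuleCat.of ℤ ℤ)).map p) 1)]
  exact Limits.zero_comp

end Chains

/-! ### Singular simplices of the mapping torus lie in sheets -/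

/-- The singular simplicial set of the real line. -/
abbrev SingLine : SSet.{0} := TopCat.toSSet.obj (TopCat.of ℝ)

/-- The flow line `s ↦ [x, s]`. -/
def flowLine (x : Seq b) : TopCat.of ℝ ⟶ TopCat.of (MappingTorus b) :=
  TopCat.ofHom ⟨fun s => cover (x, s), continuous_cover.comp (by fun_prop)⟩

/-- The singular simplex in the flow line of `x` given by a singular simplex of `ℝ`. -/
def sheet (x : Seq b) {n : ℕ} (s : SingLine _⦋n⦌) : (Sing b) _⦋n⦌ :=
  (TopCat.toSSet.map (flowLine x)).app _ s

lemma δ_sheet (x : Seq b) {n : ℕ} (s : SingLine _⦋n + 1⦌) (i : Fin (n + 2)) :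
    (Sing b).δ i (sheet x s) = sheet x (SingLine.δ i s) := rfl

instance (n : ℕ) : ContractibleSpace (stdSimplex ℝ (Fin (n + 1))) :=
  (convex_stdSimplex ℝ (Fin (n + 1))).contractibleSpace ⟨_, single_mem_stdSimplex ℝ 0⟩

instance (n : ℕ) : LocallyPathConnectedSpace (stdSimplex ℝ (Fin (n + 1))) :=
  (convex_stdSimplex ℝ (Fin (n + 1))).locallyPathConnectedSpace

lemma exists_sheet {n : ℕ} (σ : (Sing b) _⦋n⦌) :
    ∃ (x : Seq b) (s : SingLine _⦋n⦌), sheet x s = σ := by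
  obtain ⟨x, s, h⟩ := exists_lift (A := stdSimplex ℝ (Fin (n + 1))) (TopCat.toSSetObjEquiv _ _ σ)
  exact ⟨x, (TopCat.toSSetObjEquiv (TopCat.of ℝ) _).symm s,
    (TopCat.toSSetObjEquiv _ _).injective (ContinuousMap.ext fun u => (h u).symm)⟩

/-- A lift of a singular simplex of the mapping torus to a sheet. -/
def simplexLift {n : ℕ} (σ : (Sing b) _⦋n⦌) : Seq b × SingLine _⦋n⦌ :=
  ⟨(exists_sheet σ).choose, (exists_sheet σ).choose_spec.choose⟩

lemma sheet_simplexLift {n : ℕ} (σ : (Sing b) _⦋n⦌) :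
    sheet (simplexLift σ).1 (simplexLift σ).2 = σ :=
  (exists_sheet σ).choose_spec.choose_spec

lemma sheet_eq_sheet {n : ℕ} {x y : Seq b} {s t : SingLine _⦋n⦌} (h : sheet x s = sheet y t) :
    ∃ m : ℤ, translate m y = x ∧
      ∀ u, TopCat.toSSetObjEquiv _ _ t u + m = TopCat.toSSetObjEquiv _ _ s u := by
  refine lift_unique (A := stdSimplex ℝ (Fin (n + 1))) (s := TopCat.toSSetObjEquiv _ _ s)
    (t := TopCat.toSSetObjEquiv _ _ t) (fun u => ?_)
    ⟨_, single_mem_stdSimplex ℝ 0⟩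
  exact congrArg (fun σ => TopCat.toSSetObjEquiv (TopCat.of (MappingTorus b)) _ σ u) h

lemma sheet_translate {n : ℕ} (x : Seq b) (m : ℤ) {s t : SingLine _⦋n⦌}
    (h : ∀ u, TopCat.toSSetObjEquiv _ _ t u = (TopCat.toSSetObjEquiv _ _ s u + m : ℝ)) :
    sheet (translate m x) t = sheet x s := by
  refine (TopCat.toSSetObjEquiv _ _).injective (ContinuousMap.ext fun u => ?_)
  have := cover_translate m x (TopCat.toSSetObjEquiv (TopCat.of ℝ) _ s u)
  rw [← h u] at this
  exact this

/-- The bijection between singular `0`-simplices of the line and points. -/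
def lineEquiv : SingLine _⦋0⦌ ≃ ℝ := TopCat.toSSetObj₀Equiv (X := TopCat.of ℝ)

/-- The point of the line given by a singular `0`-simplex. -/
def pt (p : SingLine _⦋0⦌) : ℝ := lineEquiv p

/-- The vertex of the singular simplicial set of the line given by a real number. -/
def vertex (r : ℝ) : SingLine _⦋0⦌ := lineEquiv.symm r

@[simp] lemma pt_vertex (r : ℝ) : pt (vertex r) = r := lineEquiv.apply_symm_apply r

@[simp] lemma vertex_pt (p : SingLine _⦋0⦌) : vertex (pt p) = p := lineEquiv.symm_apply_apply p

/-- The path in the line which runs from `r` to `r'` with constant speed. -/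
def straightPath (r r' : ℝ) : TopCat.I ⟶ TopCat.of ℝ :=
  TopCat.ofHom ⟨fun t => r + (t.down : ℝ) * (r' - r), by fun_prop⟩

lemma straightPath_apply (r r' : ℝ) (t : TopCat.I) :
    straightPath r r' t = (r + (t.down : ℝ) * (r' - r) : ℝ) := rfl

/-- The straight path from `r` to `r'` as a singular simplex. -/
def straight (r r' : ℝ) : SingLine _⦋1⦌ := TopCat.toSSetObj₁Equiv.symm (straightPath r r')

@[simp] lemma δ_one_straight (r r' : ℝ) : SingLine.δ 1 (straight r r') = vertex r := by
  rw [straight, TopCat.δ_one_toSSetObj₁Equiv.symm, straightPath_apply]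
  have : r + (((0 : TopCat.I).down : unitInterval) : ℝ) * (r' - r) = r := by
    change r + 0 * (r' - r) = r
    ring
  rw [this]
  rfl

@[simp] lemma δ_zero_straight (r r' : ℝ) : SingLine.δ 0 (straight r r') = vertex r' := by
  rw [straight, TopCat.δ_zero_toSSetObj₁Equiv.symm, straightPath_apply]
  have : r + (((1 : TopCat.I).down : unitInterval) : ℝ) * (r' - r) = r' := by
    change r + 1 * (r' - r) = r'
    ring
  rw [this]
  rfl

lemma sheet_straight (x : Seq b) (r r' : ℝ) (m : ℤ) :
    sheet (translate m x) (straight (r + m) (r' + m)) = sheet x (straight r r') := by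
  refine sheet_translate x m fun u => ?_
  change straightPath (r + m) (r' + m) _ = straightPath r r' _ + (m : ℝ)
  rw [straightPath_apply, straightPath_apply]
  ring

lemma sheet_straight_eq (x : Seq b) (r r' : ℝ) :
    sheet x (straight r r') = TopCat.toSSetObj₁Equiv.symm (straightPath r r' ≫ flowLine x) := rfl

lemma sheet_straight_int (x : Seq b) (k : ℤ) :
    sheet x (straight k (k + 1)) = flowSimplex b (translate (-k) x) := by
  have := sheet_straight (translate (-k) x) 0 1 k
  rw [translate_translate, add_neg_cancel, translate_zero, zero_add, add_comm 1] at this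
  rw [this, sheet_straight_eq, flowSimplex]
  congr 1
  ext t
  refine Eq.trans ?_ (cover_unitInterval _ t.down)
  change cover (_, straightPath 0 1 t) = _
  rw [straightPath_apply]
  ring_nf

/-! ### Counting the crossings of paths with the base of the mapping torus -/

lemma d_cell_one {X : SSet.{0}} (σ : X _⦋1⦌) :
    ((X.chainComplex (ModuleCat.of ℤ ℤ)).d 1 0).hom (cell σ) =
      cell (X.δ 0 σ) - cell (X.δ 1 σ) := by
  rw [d_cell, Fin.sum_univ_two]
  simp [sub_eq_add_neg]

lemma d_cell_two {X : SSet.{0}} (σ : X _⦋2⦌) :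
    ((X.chainComplex (ModuleCat.of ℤ ℤ)).d 2 1).hom (cell σ) =
      cell (X.δ 0 σ) - cell (X.δ 1 σ) + cell (X.δ 2 σ) := by
  rw [d_cell, Fin.sum_univ_three]
  simp [sub_eq_add_neg]

/-- The points of the flow line of `x` over the integers `k` with `0 ≤ k < m`, counted with sign. -/
def crossings (x : Seq b) (m : ℤ) : Seq b →₀ ℤ :=
  intSum (fun k => Finsupp.single (translate (-k) x) 1) m

/-- Changing the lift by a deck transformation moves the origin of the count. Only differences are
unaffected, so only they descend to the mapping torus. -/
lemma crossings_translate (x : Seq b) (k m n : ℤ) :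
    crossings (translate k x) (m + k) - crossings (translate k x) (n + k) =
      crossings x m - crossings x n := by
  rw [crossings, crossings, crossings, crossings, ← intSum_shift _ k m n]
  simp only [translate_translate, neg_sub, neg_add_eq_sub]

/-- `T⁻¹` carries the point over `k` to the point over `k + 1`, so the sum telescopes to its two
ends. -/
lemma crossings_sub_mapDomain (x : Seq b) (m n : ℤ) :
    (crossings x m - crossings x n) -
        Finsupp.mapDomain (translate (-1)) (crossings x m - crossings x n) =
      Finsupp.single (translate (-n) x) 1 - Finsupp.single (translate (-m) x) 1 := by
  have h : ∀ k, Finsupp.lmapDomain ℤ ℤ (translate (-1)) (crossings x k) =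
      intSum (fun k => Finsupp.single (translate (-(k + 1)) x) (1 : ℤ)) k := fun k => by
    have := map_intSum (Finsupp.lmapDomain ℤ ℤ (translate (b := b) (-1))).toAddMonoidHom
      (fun k => Finsupp.single (translate (-k) x) (1 : ℤ)) k
    refine this.trans ?_
    simp [add_comm]
  have h' : ∀ k, crossings x (k + 1) - crossings x k = Finsupp.single (translate (-k) x) 1 :=
    fun k => by rw [crossings, crossings, intSum_succ, add_sub_cancel_left]
  change _ - Finsupp.lmapDomain ℤ ℤ (translate (-1)) _ = _
  rw [map_sub, h, h]
  have := sub_eq_sub_of_increments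
    (f := fun k => crossings x k -
      intSum (fun k => Finsupp.single (translate (-(k + 1)) x) (1 : ℤ)) k)
    (h := fun k => - Finsupp.single (translate (-k) x) 1) (fun k => by
      rw [sub_sub_sub_comm, h', intSum_succ, add_sub_cancel_left]; abel) m n
  rw [sub_sub_sub_comm, this]
  abel

lemma exists_translate_of_sheet_eq {x y : Seq b} {p q : SingLine _⦋0⦌} (h : sheet x p = sheet y q) :
    ∃ m : ℤ, translate m y = x ∧ pt q + m = pt p := by
  obtain ⟨m, hm, hm'⟩ := sheet_eq_sheet h
  exact ⟨m, hm, hm' default⟩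

/-- The signed crossings of a singular `1`-simplex of the mapping torus with its base. -/
def crossing (σ : (Sing b) _⦋1⦌) : Seq b →₀ ℤ :=
  crossings (simplexLift σ).1
      ⌊pt (SingLine.δ 0 (simplexLift σ).2)⌋ -
    crossings (simplexLift σ).1
      ⌊pt (SingLine.δ 1 (simplexLift σ).2)⌋

/-- Independence of the lift chosen in `simplexLift`. -/
lemma crossing_sheet (x : Seq b) (s : SingLine _⦋1⦌) :
    crossing (sheet x s) =
      crossings x ⌊pt (SingLine.δ 0 s)⌋ - crossings x ⌊pt (SingLine.δ 1 s)⌋ := by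
  obtain ⟨m, hm, hm'⟩ := sheet_eq_sheet (sheet_simplexLift (sheet x s))
  rw [crossing, ← hm, ← crossings_translate x m]
  have h0 : pt (SingLine.δ 0 s) + m =
    pt (SingLine.δ 0 (simplexLift (sheet x s)).2) := hm' _
  have h1 : pt (SingLine.δ 1 s) + m =
    pt (SingLine.δ 1 (simplexLift (sheet x s)).2) := hm' _
  rw [← h0, ← h1, Int.floor_add_intCast, Int.floor_add_intCast]

/-- The base point `y` such that the given point is `[y, t]` with `0 ≤ t < 1`. -/
def basePoint (p : (Sing b) _⦋0⦌) : Seq b :=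
  translate (-⌊pt (simplexLift p).2⌋) (simplexLift p).1

lemma basePoint_sheet (x : Seq b) (s : SingLine _⦋0⦌) :
    basePoint (sheet x s) = translate (-⌊pt s⌋) x := by
  obtain ⟨m, hm, hm'⟩ :=
    exists_translate_of_sheet_eq (sheet_simplexLift (sheet x s))
  rw [basePoint, ← hm, ← hm', Int.floor_add_intCast, translate_translate]
  congr 1
  ring

/-- The flow segment from the base of the mapping torus to the given point. -/
def stem (p : (Sing b) _⦋0⦌) : (Sing b) _⦋1⦌ :=
  sheet (simplexLift p).1 (straight ⌊pt (simplexLift p).2⌋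
    (pt (simplexLift p).2))

lemma stem_sheet (x : Seq b) (s : SingLine _⦋0⦌) :
    stem (sheet x s) = sheet x (straight ⌊pt s⌋ (pt s)) := by
  obtain ⟨m, hm, hm'⟩ :=
    exists_translate_of_sheet_eq (sheet_simplexLift (sheet x s))
  rw [stem, ← hm, ← hm', Int.floor_add_intCast, ← sheet_straight x _ _ m]
  push_cast
  rfl

/-- The triangle lies in one sheet, where the crossing of an edge is the difference of a function of
its vertices. -/
lemma crossing_boundary (τ : (Sing b) _⦋2⦌) :
    crossing ((Sing b).δ 0 τ) - crossing ((Sing b).δ 1 τ) + crossing ((Sing b).δ 2 τ) = 0 := by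
  obtain ⟨x, s, rfl⟩ := exists_sheet τ
  simp only [δ_sheet, crossing_sheet]
  have h1 : SingLine.δ 0 (SingLine.δ 1 s) = SingLine.δ 0 (SingLine.δ 0 s) :=
    ConcreteCategory.congr_hom (SingLine.δ_comp_δ (i := (0 : Fin 2)) (j := 0) le_rfl) s
  have h2 : SingLine.δ 0 (SingLine.δ 2 s) = SingLine.δ 1 (SingLine.δ 0 s) :=
    ConcreteCategory.congr_hom (SingLine.δ_comp_δ (i := (0 : Fin 2)) (j := 1) zero_le_one) s
  have h3 : SingLine.δ 1 (SingLine.δ 2 s) = SingLine.δ 1 (SingLine.δ 1 s) :=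
    ConcreteCategory.congr_hom (SingLine.δ_comp_δ (i := (1 : Fin 2)) (j := 1) le_rfl) s
  rw [h1, h2, h3]
  abel

/-- The right-hand side depends only on the boundary of `σ`; this is why the crossings of a cycle
are shift-invariant. -/
lemma crossing_sub_mapDomain (σ : (Sing b) _⦋1⦌) :
    crossing σ - Finsupp.mapDomain (translate (-1)) (crossing σ) =
      Finsupp.single (basePoint ((Sing b).δ 1 σ)) 1 -
        Finsupp.single (basePoint ((Sing b).δ 0 σ)) 1 := by
  obtain ⟨x, s, rfl⟩ := exists_sheet σ
  rw [δ_sheet, δ_sheet, crossing_sheet, basePoint_sheet, basePoint_sheet, crossings_sub_mapDomain]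

lemma crossing_flowSimplex (x : Seq b) : crossing (flowSimplex b x) = Finsupp.single x 1 := by
  have := sheet_straight_int x 0
  rw [neg_zero, translate_zero] at this
  rw [← this, crossing_sheet, δ_zero_straight, δ_one_straight, pt_vertex, pt_vertex]
  have h := intSum_succ (fun k => Finsupp.single (translate (-k) x) (1 : ℤ)) 0
  simp [crossings] at h ⊢
  exact h

/-! ### The homology of the mapping torus embeds into the invariant functions on `𝒮` -/

lemma exists_d_eq_of_d_eq_zero
    (c : (SingLine.chainComplex (ModuleCat.of ℤ ℤ)).X 1)
    (hc : ((SingLine.chainComplex (ModuleCat.of ℤ ℤ)).d 1 0).hom c = 0) :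
    ∃ e, ((SingLine.chainComplex (ModuleCat.of ℤ ℤ)).d 2 1).hom e = c := by
  have h := isZero_homology_one_of_contractible (TopCat.of ℝ)
  rw [← HomologicalComplex.exactAt_iff_isZero_homology,
    HomologicalComplex.exactAt_iff' _ 2 1 0 (by simp) (by simp),
    ShortComplex.moduleCat_exact_iff] at h
  exact h c hc

/-- The chains of the mapping torus modulo boundaries. -/
abbrev ChainsModBoundaries (b : FreeGroupBasis (Fin g) Γ) : ModuleCat.{0} ℤ :=
  ((Sing b).chainComplex (ModuleCat.of ℤ ℤ)).opcycles 1

/-- The class of a chain modulo boundaries. -/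
def toModBoundaries :
    ((Sing b).chainComplex (ModuleCat.of ℤ ℤ)).X 1 →ₗ[ℤ] ChainsModBoundaries b :=
  (((Sing b).chainComplex (ModuleCat.of ℤ ℤ)).pOpcycles 1).hom

lemma toModBoundaries_d (c : ((Sing b).chainComplex (ModuleCat.of ℤ ℤ)).X 2) :
    toModBoundaries ((((Sing b).chainComplex (ModuleCat.of ℤ ℤ)).d 2 1).hom c) = 0 :=
  ConcreteCategory.congr_hom (((Sing b).chainComplex (ModuleCat.of ℤ ℤ)).d_pOpcycles 2 1) c

/-- The homomorphism from chains in the line to chains in a flow line. -/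
def sheetChain (x : Seq b) (n : ℕ) : (SingLine.chainComplex (ModuleCat.of ℤ ℤ)).X n →ₗ[ℤ]
    ((Sing b).chainComplex (ModuleCat.of ℤ ℤ)).X n :=
  ((SSet.chainComplexMap (TopCat.toSSet.map (flowLine x)) (ModuleCat.of ℤ ℤ)).f n).hom

lemma sheetChain_cell (x : Seq b) {n : ℕ} (s : SingLine _⦋n⦌) :
    sheetChain x n (cell s) = cell (sheet x s) :=
  chainComplexMap_cell _ s

lemma toModBoundaries_sheetChain (x : Seq b)
    (c : (SingLine.chainComplex (ModuleCat.of ℤ ℤ)).X 1)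
    (hc : ((SingLine.chainComplex (ModuleCat.of ℤ ℤ)).d 1 0).hom c = 0) :
    toModBoundaries (sheetChain x 1 c) = 0 := by
  obtain ⟨e, rfl⟩ := exists_d_eq_of_d_eq_zero c hc
  have := ConcreteCategory.congr_hom ((SSet.chainComplexMap (TopCat.toSSet.map (flowLine x))
    (ModuleCat.of ℤ ℤ)).comm 2 1) e
  refine (congrArg toModBoundaries this.symm).trans ?_
  exact toModBoundaries_d _

/-- The linear extension of `crossing` to chains. -/
def crossingChain : ((Sing b).chainComplex (ModuleCat.of ℤ ℤ)).X 1 →ₗ[ℤ] (Seq b →₀ ℤ) :=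
  chainLift crossing

/-- The linear extension of `flowSimplex` to finitely supported functions. -/
def flowChain : (Seq b →₀ ℤ) →ₗ[ℤ] ((Sing b).chainComplex (ModuleCat.of ℤ ℤ)).X 1 :=
  Finsupp.linearCombination ℤ fun x => cell (flowSimplex b x)

/-- The linear extension of `stem` to chains. -/
def stemChain : ((Sing b).chainComplex (ModuleCat.of ℤ ℤ)).X 0 →ₗ[ℤ]
    ((Sing b).chainComplex (ModuleCat.of ℤ ℤ)).X 1 :=
  chainLift fun p => cell (stem p)

lemma crossingChain_d (c : ((Sing b).chainComplex (ModuleCat.of ℤ ℤ)).X 2) :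
    crossingChain ((((Sing b).chainComplex (ModuleCat.of ℤ ℤ)).d 2 1).hom c) = 0 := by
  have : crossingChain ∘ₗ (((Sing b).chainComplex (ModuleCat.of ℤ ℤ)).d 2 1).hom = 0 := by
    refine chain_ext fun τ => ?_
    rw [LinearMap.comp_apply, d_cell_two, map_add, map_sub, crossingChain, chainLift_cell,
      chainLift_cell, chainLift_cell, crossing_boundary]
    rfl
  exact LinearMap.congr_fun this c

lemma mapDomain_crossingChain (c : ((Sing b).chainComplex (ModuleCat.of ℤ ℤ)).X 1)
    (hc : (((Sing b).chainComplex (ModuleCat.of ℤ ℤ)).d 1 0).hom c = 0) :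
    Finsupp.mapDomain (translate (-1)) (crossingChain c) = crossingChain c := by
  have : crossingChain - Finsupp.lmapDomain ℤ ℤ (translate (-1)) ∘ₗ crossingChain =
      (- chainLift fun p => Finsupp.single (basePoint (b := b) p) (1 : ℤ)) ∘ₗ
        (((Sing b).chainComplex (ModuleCat.of ℤ ℤ)).d 1 0).hom := by
    refine chain_ext fun σ => ?_
    rw [LinearMap.comp_apply, d_cell_one, map_sub, LinearMap.neg_apply, LinearMap.neg_apply,
      chainLift_cell, chainLift_cell, LinearMap.sub_apply, LinearMap.comp_apply, crossingChain,
      chainLift_cell]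
    refine (crossing_sub_mapDomain σ).trans ?_
    abel
  have h := LinearMap.congr_fun this c
  rw [LinearMap.comp_apply, hc, map_zero] at h
  exact (sub_eq_zero.1 h).symm

/-- Exhibits the flow segments as the image of a chain in the line, so that they can be compared
with other paths there. -/
lemma flowChain_crossings (x : Seq b) (m : ℤ) :
    flowChain (crossings x m) =
      sheetChain x 1 (intSum (fun k : ℤ => cell (straight k (k + 1))) m) := by
  have h1 := map_intSum (flowChain (b := b)).toAddMonoidHom
    (fun k => Finsupp.single (translate (-k) x) (1 : ℤ)) m
  have h2 := map_intSum (sheetChain x 1).toAddMonoidHom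
    (fun k : ℤ => cell (straight k (k + 1))) m
  refine h1.trans (Eq.trans ?_ h2.symm)
  congr 1
  ext1 k
  change flowChain _ = sheetChain x 1 _
  rw [sheetChain_cell, sheet_straight_int, flowChain, Finsupp.linearCombination_single]
  exact (int_smul_eq_zsmul _ _ _).trans (one_zsmul _)

lemma d_intSum_straight (m n : ℤ) :
    ((SingLine.chainComplex (ModuleCat.of ℤ ℤ)).d 1 0).hom
        (intSum (fun k : ℤ => cell (straight k (k + 1))) m -
          intSum (fun k : ℤ => cell (straight k (k + 1))) n) =
      cell (vertex m) - cell (vertex n) := by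
  have h := fun m => map_intSum
    ((SingLine.chainComplex (ModuleCat.of ℤ ℤ)).d 1 0).hom.toAddMonoidHom
    (fun k : ℤ => cell (straight k (k + 1))) m
  rw [map_sub]
  refine (congrArg₂ (· - ·) (h m) (h n)).trans ?_
  refine intSum_sub_intSum (f := fun k : ℤ => cell (vertex k)) (fun k => ?_) m n
  refine Eq.trans ?_ (d_cell_one _).symm
  simp

/-- Modulo boundaries, a chain is determined by its boundary and its crossings. -/
lemma toModBoundaries_eq (c : ((Sing b).chainComplex (ModuleCat.of ℤ ℤ)).X 1) :
    toModBoundaries c = toModBoundaries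
      (stemChain ((((Sing b).chainComplex (ModuleCat.of ℤ ℤ)).d 1 0).hom c) +
        flowChain (crossingChain c)) := by
  have : toModBoundaries = toModBoundaries ∘ₗ
      (stemChain ∘ₗ (((Sing b).chainComplex (ModuleCat.of ℤ ℤ)).d 1 0).hom +
        flowChain ∘ₗ crossingChain) := by
    refine chain_ext fun σ => ?_
    obtain ⟨x, s, rfl⟩ := exists_sheet σ
    rw [LinearMap.comp_apply, LinearMap.add_apply, LinearMap.comp_apply, LinearMap.comp_apply,
      d_cell_one, map_sub, stemChain, chainLift_cell, chainLift_cell, crossingChain,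
      chainLift_cell, δ_sheet, δ_sheet, stem_sheet, stem_sheet, crossing_sheet, map_sub,
      flowChain_crossings, flowChain_crossings, ← sub_eq_zero, ← map_sub, ← sheetChain_cell,
      ← sheetChain_cell, ← sheetChain_cell, ← map_sub, ← map_sub, ← map_add, ← map_sub]
    -- The difference is now the image of a chain in ℝ: the path, the stems at its ends, and the
    -- unit segments between the floors. Together they close up, and every 1-cycle in ℝ bounds.
    refine toModBoundaries_sheetChain x _ ?_
    rw [map_sub, map_add, map_sub, d_intSum_straight, d_cell_one, d_cell_one, d_cell_one]
    simp only [δ_zero_straight, δ_one_straight, vertex_pt]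
    abel
  exact LinearMap.congr_fun this c

/-- The homomorphism which sends a homology class to its crossings with the base of the mapping
torus. -/
def crossingHom (b : FreeGroupBasis (Fin g) Γ) : H1 b →ₗ[ℤ] (Seq b →₀ ℤ) :=
  (((Sing b).chainComplex (ModuleCat.of ℤ ℤ)).homologyι 1 ≫
    ((Sing b).chainComplex (ModuleCat.of ℤ ℤ)).descOpcycles
      (ModuleCat.ofHom (crossingChain (b := b))) 2 (by simp)
      (ModuleCat.hom_ext (LinearMap.ext fun c => crossingChain_d c))).hom

lemma crossingHom_homologyπ (z : ((Sing b).chainComplex (ModuleCat.of ℤ ℤ)).cycles 1) :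
    crossingHom b ((((Sing b).chainComplex (ModuleCat.of ℤ ℤ)).homologyπ 1).hom z) =
      crossingChain ((((Sing b).chainComplex (ModuleCat.of ℤ ℤ)).iCycles 1).hom z) := by
  have := ((Sing b).chainComplex (ModuleCat.of ℤ ℤ)).homology_π_ι_assoc 1
    (((Sing b).chainComplex (ModuleCat.of ℤ ℤ)).descOpcycles
      (ModuleCat.ofHom (crossingChain (b := b))) 2 (by simp)
      (ModuleCat.hom_ext (LinearMap.ext fun c => crossingChain_d c)))
  exact ConcreteCategory.congr_hom
    (this.trans (congrArg (_ ≫ ·) (HomologicalComplex.p_descOpcycles _ _ _ _ _))) z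

lemma exists_cycle (h : H1 b) : ∃ z : ((Sing b).chainComplex (ModuleCat.of ℤ ℤ)).cycles 1,
    (((Sing b).chainComplex (ModuleCat.of ℤ ℤ)).homologyπ 1).hom z = h :=
  (ModuleCat.epi_iff_surjective _).1
    (inferInstanceAs (Epi (((Sing b).chainComplex (ModuleCat.of ℤ ℤ)).homologyπ 1))) h

lemma d_iCycles (z : ((Sing b).chainComplex (ModuleCat.of ℤ ℤ)).cycles 1) :
    (((Sing b).chainComplex (ModuleCat.of ℤ ℤ)).d 1 0).hom
      ((((Sing b).chainComplex (ModuleCat.of ℤ ℤ)).iCycles 1).hom z) = 0 :=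
  ConcreteCategory.congr_hom (((Sing b).chainComplex (ModuleCat.of ℤ ℤ)).iCycles_d 1 0) z

/-- A cycle without crossings vanishes modulo boundaries by `toModBoundaries_eq`, and homology
embeds into chains modulo boundaries. -/
lemma crossingHom_injective : Function.Injective (crossingHom b) := by
  rw [injective_iff_map_eq_zero]
  intro h hh
  obtain ⟨z, rfl⟩ := exists_cycle h
  rw [crossingHom_homologyπ] at hh
  have h1 := toModBoundaries_eq ((((Sing b).chainComplex (ModuleCat.of ℤ ℤ)).iCycles 1).hom z)
  rw [hh, d_iCycles, map_zero, map_zero, add_zero, map_zero] at h1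
  have h2 := ConcreteCategory.congr_hom
    (((Sing b).chainComplex (ModuleCat.of ℤ ℤ)).homology_π_ι 1) z
  have hm : Mono (((Sing b).chainComplex (ModuleCat.of ℤ ℤ)).homologyι 1) := inferInstance
  refine (ModuleCat.mono_iff_injective _).1 hm ?_
  refine (h2.trans h1).trans (map_zero _).symm

lemma mapDomain_crossingHom (h : H1 b) :
    Finsupp.mapDomain (translate (-1)) (crossingHom b h) = crossingHom b h := by
  obtain ⟨z, rfl⟩ := exists_cycle h
  rw [crossingHom_homologyπ]
  exact mapDomain_crossingChain _ (d_iCycles z)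

lemma crossingHom_orbitClass (x : Seq b) :
    crossingHom b (orbitClass b x) = ∑ k ∈ Finset.range (period x),
      Finsupp.single (translate k x) (1 : ℤ) := by
  rw [orbitClass]
  refine (crossingHom_homologyπ _).trans ?_
  have := ConcreteCategory.congr_hom (((Sing b).chainComplex (ModuleCat.of ℤ ℤ)).liftCycles_i
    (orbitChain b x (Function.minimalPeriod (shift b) x)) 0 (by simp)
      (orbitChain_d b x _ (Function.iterate_minimalPeriod))) (1 : ℤ)
  refine (congrArg crossingChain this).trans ?_
  have e : (orbitChain b x (Function.minimalPeriod (shift b) x)).hom (1 : ℤ) =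
      ∑ k ∈ Finset.range (period x),
        cell (flowSimplex b ((shift b)^[k] x)) := by
    simp [orbitChain, cell, ModuleCat.hom_sum]
  refine (congrArg crossingChain e).trans ?_
  rw [map_sum]
  refine Finset.sum_congr rfl fun k _ => ?_
  rw [crossingChain, chainLift_cell, crossing_flowSimplex, shift_iterate]

end Homology

/-! ### Periodic points of the shift and their orbits -/

lemma isPeriodicPt_shift_iff {n : ℕ} {x : Seq b} :
    Function.IsPeriodicPt (shift b) n x ↔ translate n x = x := by
  rw [Function.IsPeriodicPt, Function.IsFixedPt, shift_iterate]

lemma translate_eq_self_iff {n : ℕ} {x : Seq b} : translate n x = x ↔ period x ∣ n := by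
  rw [← isPeriodicPt_shift_iff, Function.isPeriodicPt_iff_minimalPeriod_dvd]

@[simp]
lemma period_translate (m : ℤ) (x : Seq b) : period (translate m x) = period x := by
  refine Function.minimalPeriod_eq_minimalPeriod_iff.2 fun n => ?_
  rw [isPeriodicPt_shift_iff, isPeriodicPt_shift_iff, translate_translate, add_comm,
    ← translate_translate, (translate_injective m).eq_iff]

lemma translate_mul_of_eq {n : ℤ} {x : Seq b} (h : translate n x = x) (j : ℤ) :
    translate (n * j) x = x := by
  induction j with
  | zero => simp
  | succ j ih => rw [mul_add, mul_one, ← translate_translate, h, ih]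
  | pred j ih =>
    conv_lhs => rw [← h]
    rw [translate_translate, mul_sub, mul_one, sub_add_cancel, ih]

lemma translate_emod {n : ℤ} {x : Seq b} (h : translate n x = x) (m : ℤ) :
    translate (m % n) x = translate m x := by
  conv_rhs => rw [← Int.emod_add_mul_ediv m n, ← translate_translate, translate_mul_of_eq h]

/-- Two points are equivalent if they are in the same orbit of the shift. -/
def orbitSetoid (b : FreeGroupBasis (Fin g) Γ) : Setoid (Seq b) where
  r x y := ∃ m : ℤ, translate m x = y
  iseqv :=
    { refl := fun x => ⟨0, translate_zero x⟩
      symm := by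
        rintro x _ ⟨m, rfl⟩
        exact ⟨-m, by simp⟩
      trans := by
        rintro x _ _ ⟨m, rfl⟩ ⟨n, rfl⟩
        exact ⟨n + m, by simp⟩ }

/-- A representative of the orbit of a point. -/
def rep (x : Seq b) : Seq b := (Quotient.mk (orbitSetoid b) x).out

lemma exists_translate_rep (x : Seq b) : ∃ m : ℤ, translate m (rep x) = x :=
  Quotient.exact (s := orbitSetoid b) (Quotient.out_eq _)

@[simp]
lemma rep_translate (m : ℤ) (x : Seq b) : rep (translate m x) = rep x :=
  congrArg Quotient.out (Quotient.sound (s := orbitSetoid b) ⟨-m, by simp⟩)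

@[simp]
lemma rep_rep (x : Seq b) : rep (rep x) = rep x := by
  obtain ⟨m, hm⟩ := exists_translate_rep x
  conv_rhs => rw [← hm, rep_translate]

@[simp]
lemma period_rep (x : Seq b) : period (rep x) = period x := by
  obtain ⟨m, hm⟩ := exists_translate_rep x
  conv_rhs => rw [← hm, period_translate]

/-- The representatives of the finite orbits of the shift. -/
abbrev Rep (b : FreeGroupBasis (Fin g) Γ) : Type := {x : Seq b // rep x = x ∧ 0 < period x}

/-- Within one minimal period an orbit passes through its representative exactly once, at `k = 0`,
and never through another representative. -/
lemma sum_translate_apply (x y : Rep b) :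
    (∑ k ∈ Finset.range (period x.1), Finsupp.single (translate k x.1) (1 : ℤ)) y.1 =
      Finsupp.single x (1 : ℤ) y := by
  classical
  rw [Finsupp.finsetSum_apply, Finsupp.single_apply]
  split_ifs with h
  · subst h
    rw [Finset.sum_eq_single_of_mem 0 (Finset.mem_range.2 x.2.2)]
    · simp
    · intro k hk hk0
      refine Finsupp.single_eq_of_ne fun h => hk0 ?_
      exact Nat.eq_zero_of_dvd_of_lt (translate_eq_self_iff.1 h.symm) (Finset.mem_range.1 hk)
  · refine Finset.sum_eq_zero fun k _ => Finsupp.single_eq_of_ne fun h' => h (Subtype.ext ?_)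
    rw [← x.2.1, ← y.2.1, h', rep_translate]

/-- The restriction of the crossings of a homology class to the representatives of the orbits. -/
def repCrossing (b : FreeGroupBasis (Fin g) Γ) : H1 b →ₗ[ℤ] (Rep b →₀ ℤ) :=
  Finsupp.lcomapDomain (fun x : Rep b => x.1) Subtype.val_injective ∘ₗ crossingHom b

lemma repCrossing_apply (h : H1 b) (x : Rep b) : repCrossing b h x = crossingHom b h x.1 := rfl

lemma repCrossing_orbitClass (x : Rep b) :
    repCrossing b (orbitClass b x.1) = Finsupp.single x 1 := by
  ext y
  rw [repCrossing_apply, crossingHom_orbitClass]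
  exact sum_translate_apply x y

lemma crossingHom_translate (h : H1 b) (m : ℤ) (z : Seq b) :
    crossingHom b h (translate m z) = crossingHom b h z := by
  have key : ∀ z, crossingHom b h (translate (-1) z) = crossingHom b h z := fun z => by
    conv_lhs => rw [← mapDomain_crossingHom h]
    exact Finsupp.mapDomain_apply (translate_injective (-1)) _ _
  induction m with
  | zero => simp
  | succ m ih =>
    rw [← key, translate_translate, neg_add_cancel_comm_assoc, ih]
  | pred m ih => rw [← ih, ← key (translate (-m) z), translate_translate, sub_eq_neg_add]

/-- By invariance all translates of `z` lie in the finite support, so two of them coincide. -/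
lemma period_pos_of_crossingHom_ne_zero {h : H1 b} {z : Seq b} (hz : crossingHom b h z ≠ 0) :
    0 < period z := by
  have hs : ∀ m : ℤ, translate m z ∈ (crossingHom b h).support := fun m => by
    rwa [Finsupp.mem_support_iff, crossingHom_translate]
  obtain ⟨m, n, hmn, h⟩ := Finite.exists_ne_map_eq_of_infinite
    fun m : ℤ => (⟨translate m z, hs m⟩ : (crossingHom b h).support)
  replace h : translate m z = translate n z := congrArg Subtype.val h
  wlog hlt : m < n generalizing m n
  · exact this n m hmn.symm h.symm (lt_of_le_of_ne (not_lt.1 hlt) hmn.symm)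
  have h' : translate ((n - m).toNat : ℤ) z = z := by
    rw [Int.toNat_of_nonneg (by omega)]
    have := congrArg (translate (-m)) h
    simpa [neg_add_eq_sub] using this.symm
  exact Nat.pos_of_dvd_of_pos (translate_eq_self_iff.1 h') (by omega)

/-- An invariant function is determined by its values on representatives, and non-periodic points
contribute nothing. -/
lemma repCrossing_injective : Function.Injective (repCrossing b) := by
  rw [injective_iff_map_eq_zero]
  intro h hh
  refine crossingHom_injective ?_
  rw [map_zero]
  ext z
  by_contra hz
  have hp := period_pos_of_crossingHom_ne_zero hz
  obtain ⟨m, hm⟩ := exists_translate_rep z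
  have : crossingHom b h (rep z) = 0 :=
    DFunLike.congr_fun hh (⟨rep z, rep_rep z, by rwa [period_rep]⟩ : Rep b)
  rw [← crossingHom_translate h m, hm] at this
  exact hz this

lemma repCrossing_surjective : Function.Surjective (repCrossing b) := fun f => by
  induction f using Finsupp.induction_linear with
  | zero => exact ⟨0, map_zero _⟩
  | add f f' hf hf' =>
    obtain ⟨h, rfl⟩ := hf
    obtain ⟨h', rfl⟩ := hf'
    exact ⟨h + h', map_add _ _ _⟩
  | single x c =>
    refine ⟨c • orbitClass b x.1, ?_⟩
    rw [map_zsmul, repCrossing_orbitClass, Finsupp.smul_single, smul_eq_mul, mul_one]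

/-- The classes of the closed orbits form a basis of the homology of the mapping torus. -/
def orbitBasis (b : FreeGroupBasis (Fin g) Γ) : Module.Basis (Rep b) ℤ (H1 b) :=
  ⟨LinearEquiv.ofBijective (repCrossing b) ⟨repCrossing_injective, repCrossing_surjective⟩⟩

lemma orbitBasis_apply (x : Rep b) : orbitBasis b x = orbitClass b x.1 := by
  refine repCrossing_injective ?_
  rw [repCrossing_orbitClass]
  exact (orbitBasis b).repr_self x

lemma orbitClass_translate (m : ℤ) (x : Seq b) :
    orbitClass b (translate m x) = orbitClass b x := by
  have key : ∀ x : Seq b, orbitClass b (translate 1 x) = orbitClass b x := fun x => by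
    refine crossingHom_injective ?_
    rw [crossingHom_orbitClass, crossingHom_orbitClass, period_translate]
    have h1 := Finset.sum_range_succ (fun k => Finsupp.single (translate k x) (1 : ℤ)) (period x)
    have h2 := Finset.sum_range_succ' (fun k => Finsupp.single (translate k x) (1 : ℤ)) (period x)
    rw [translate_eq_self_iff.2 dvd_rfl] at h1
    rw [h1] at h2
    simpa using h2.symm
  induction m with
  | zero => simp
  | succ m ih => rw [add_comm, ← translate_translate, key, ih]
  | pred m ih =>
    rw [← ih, ← key (translate (-m - 1) x), translate_translate, add_sub_cancel]

lemma orbitClass_rep (x : Seq b) : orbitClass b (rep x) = orbitClass b x := by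
  obtain ⟨m, hm⟩ := exists_translate_rep x
  conv_rhs => rw [← hm, orbitClass_translate]

lemma orbitClass_of_period_eq_zero {x : Seq b} (h : period x = 0) : orbitClass b x = 0 := by
  refine crossingHom_injective ?_
  rw [crossingHom_orbitClass, h]
  simp

lemma R_eq_span {N : ℕ} : R b N = Submodule.span ℤ (orbitBasis b '' {x | period x.1 = N}) := by
  refine le_antisymm (Submodule.span_le.2 ?_) (Submodule.span_mono ?_)
  · rintro _ ⟨x, hx, rfl⟩
    -- Minimal period 0 means non-periodic; such points have class 0 and are absent from `Rep`.
    rcases Nat.eq_zero_or_pos N with rfl | hN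
    · rw [orbitClass_of_period_eq_zero hx]
      exact Submodule.zero_mem _
    · refine Submodule.subset_span ⟨⟨rep x, rep_rep x, ((period_rep x).trans hx).symm ▸ hN⟩, ?_, ?_⟩
      · exact (period_rep x).trans hx
      · rw [orbitBasis_apply, orbitClass_rep]
  · rintro _ ⟨x, hx, rfl⟩
    exact ⟨x.1, hx, (orbitBasis_apply x).symm⟩

/-! ### Letters -/

/-- The homomorphism to `ℤ` which sends each free generator to `1`. -/
def exponentSum (b : FreeGroupBasis (Fin g) Γ) : Γ →* Multiplicative ℤ :=
  b.lift fun _ => Multiplicative.ofAdd 1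

lemma exponentSum_basis (i : Fin g) : exponentSum b (b i) = Multiplicative.ofAdd 1 := by
  have := congrFun (b.lift.symm_apply_apply fun _ => Multiplicative.ofAdd (1 : ℤ)) i
  exact this

/-- Exponent sums 1 and -1 differ. Hence there are exactly `2g` letters, none its own inverse. -/
lemma basis_ne_inv (i j : Fin g) : b i ≠ (b j)⁻¹ := fun h => by
  have := congrArg (exponentSum b) h
  rw [map_inv, exponentSum_basis, exponentSum_basis] at this
  exact absurd (congrArg Multiplicative.toAdd this) (by decide)

/-- The letters are the generators and their inverses. -/
def letterEquiv (b : FreeGroupBasis (Fin g) Γ) : Fin g ⊕ Fin g ≃ Letter b :=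
  Equiv.ofBijective
    (Sum.elim (fun i => ⟨b i, i, Or.inl rfl⟩) (fun i => ⟨(b i)⁻¹, i, Or.inr rfl⟩)) <| by
      constructor
      · rintro (i | i) (j | j) h
        · exact congrArg Sum.inl (b.injective (congrArg Subtype.val h))
        · exact absurd (congrArg Subtype.val h) (basis_ne_inv i j)
        · exact absurd (congrArg Subtype.val h).symm (basis_ne_inv j i)
        · exact congrArg Sum.inr (b.injective (inv_injective (congrArg Subtype.val h)))
      · rintro ⟨γ, i, rfl | rfl⟩
        · exact ⟨Sum.inl i, rfl⟩
        · exact ⟨Sum.inr i, rfl⟩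

instance : Fintype (Letter b) := Fintype.ofEquiv _ (letterEquiv b)

instance : DecidableEq (Letter b) := Classical.decEq _

instance : DecidableRel (Admissible (b := b)) := Classical.decRel _

lemma card_letter : Fintype.card (Letter b) = 2 * g := by
  rw [← Fintype.card_congr (letterEquiv b)]
  simp [two_mul]

/-- The inverse of a letter. -/
def letterInv (a : Letter b) : Letter b :=
  ⟨a.1⁻¹, by
    obtain ⟨γ, i, rfl | rfl⟩ := a
    · exact ⟨i, Or.inr rfl⟩
    · exact ⟨i, Or.inl (inv_inv _)⟩⟩

@[simp]
lemma letterInv_letterInv (a : Letter b) : letterInv (letterInv a) = a := Subtype.ext (inv_inv _)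

lemma letterInv_ne (a : Letter b) : letterInv a ≠ a := fun h => by
  obtain ⟨γ, i, rfl | rfl⟩ := a
  · exact basis_ne_inv i i (congrArg Subtype.val h).symm
  · exact basis_ne_inv i i (by simpa [letterInv] using congrArg Subtype.val h)

lemma admissible_iff {a a' : Letter b} : Admissible a a' ↔ a' ≠ letterInv a :=
  not_congr ⟨fun h => Subtype.ext h, fun h => congrArg Subtype.val h⟩

/-! ### Counting cyclically admissible words -/

open Matrix

/-- The transition matrix of the subshift. -/
def transition (b : FreeGroupBasis (Fin g) Γ) : Matrix (Letter b) (Letter b) ℤ :=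
  Matrix.of fun a a' => if Admissible a a' then 1 else 0

/-- The permutation matrix of the inversion of letters. -/
def inversion (b : FreeGroupBasis (Fin g) Γ) : Matrix (Letter b) (Letter b) ℤ :=
  Matrix.of fun a a' => if a' = letterInv a then 1 else 0

/-- The matrix all of whose entries are `1`. -/
def allOnes (b : FreeGroupBasis (Fin g) Γ) : Matrix (Letter b) (Letter b) ℤ :=
  Matrix.of fun _ _ => 1

lemma transition_eq : transition b = allOnes b - inversion b := by
  ext a a'
  simp only [transition, allOnes, inversion, Matrix.sub_apply, Matrix.of_apply, admissible_iff]
  split_ifs <;> simp_all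

lemma allOnes_mul_allOnes : allOnes b * allOnes b = (2 * g : ℤ) • allOnes b := by
  ext a a'
  simp [allOnes, Matrix.mul_apply, card_letter]

lemma inversion_mul_allOnes : inversion b * allOnes b = allOnes b := by
  ext a a'
  simp [allOnes, inversion, Matrix.mul_apply]

lemma allOnes_mul_inversion : allOnes b * inversion b = allOnes b := by
  ext a a'
  have : ∀ c : Letter b, a' = letterInv c ↔ c = letterInv a' := fun c =>
    ⟨fun h => by rw [h, letterInv_letterInv], fun h => by rw [h, letterInv_letterInv]⟩
  simp [allOnes, inversion, Matrix.mul_apply, this]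

lemma inversion_mul_inversion : inversion b * inversion b = 1 := by
  ext a a'
  simp only [inversion, Matrix.mul_apply, Matrix.of_apply, ite_mul, one_mul, zero_mul,
    Finset.sum_ite_eq', Finset.mem_univ, if_true, letterInv_letterInv, Matrix.one_apply,
    eq_comm (a := a)]

lemma trace_allOnes : (allOnes b).trace = 2 * g := by
  simp [allOnes, Matrix.trace, card_letter]

lemma trace_inversion : (inversion b).trace = 0 := by
  simp [inversion, Matrix.trace, (letterInv_ne _).symm]

lemma inversion_pow_mul_allOnes (n : ℕ) :
    (-inversion b) ^ n * allOnes b = (-1 : ℤ) ^ n • allOnes b := by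
  induction n with
  | zero => simp
  | succ n ih =>
    rw [pow_succ', Matrix.mul_assoc, ih, Matrix.mul_smul, Matrix.neg_mul, inversion_mul_allOnes,
      pow_succ, mul_neg_one, neg_smul, smul_neg]

/-- Write `J` for `allOnes` and `P` for `inversion`: `P² = 1`, `PJ = JP = J`, `J² = 2g J`. So `J -
P` acts by `2g - 1` on constant vectors and as `-P` on vectors of sum zero. The factor `2g` clears
the denominator of the projector `J / 2g`. -/
lemma transition_pow (n : ℕ) :
    (2 * g : ℤ) • transition b ^ n =
      (2 * g : ℤ) • (-inversion b) ^ n + ((2 * g - 1 : ℤ) ^ n - (-1) ^ n) • allOnes b := by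
  induction n with
  | zero => simp
  | succ n ih =>
    rw [pow_succ, ← Matrix.smul_mul, ih, transition_eq, Matrix.add_mul, Matrix.mul_sub,
      Matrix.mul_sub, Matrix.smul_mul, Matrix.smul_mul, Matrix.smul_mul, Matrix.smul_mul,
      inversion_pow_mul_allOnes, allOnes_mul_allOnes, allOnes_mul_inversion,
      pow_succ (-inversion b), Matrix.mul_neg, pow_succ, pow_succ]
    module

lemma trace_neg_inversion_pow (n : ℕ) :
    ((-inversion b) ^ n).trace = if Even n then (2 * g : ℤ) else 0 := by
  have h2 : (-inversion b) ^ 2 = 1 := by rw [neg_sq, sq, inversion_mul_inversion]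
  split_ifs with h
  · obtain ⟨k, rfl⟩ := h
    rw [← two_mul, pow_mul, h2, one_pow, Matrix.trace_one, card_letter]
    push_cast
    rfl
  · obtain ⟨k, rfl⟩ := Nat.not_even_iff_odd.1 h
    rw [pow_succ, pow_mul, h2, one_pow, one_mul, Matrix.trace_neg, trace_inversion, neg_zero]

lemma trace_transition_pow (hg : g ≠ 0) (n : ℕ) :
    (transition b ^ n).trace =
      if Even n then (2 * g - 1 : ℤ) ^ n + (2 * g - 1) else (2 * g - 1 : ℤ) ^ n + 1 := by
  have h := congrArg Matrix.trace (transition_pow (b := b) n)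
  rw [Matrix.trace_add, Matrix.trace_smul, Matrix.trace_smul, Matrix.trace_smul,
    trace_neg_inversion_pow, trace_allOnes] at h
  have hg' : (2 * g : ℤ) ≠ 0 := by positivity
  refine mul_left_cancel₀ hg' (Eq.trans h ?_)
  split_ifs with hn
  · rw [hn.neg_one_pow]; simp only [smul_eq_mul]; ring
  · rw [(Nat.not_even_iff_odd.1 hn).neg_one_pow]; simp only [smul_eq_mul]; ring

/-- Expansion over walks starting at `a`. The free weight `h` on the last letter is later taken to
be a column of the transition matrix, which closes the walk. -/
lemma transition_pow_mulVec (n : ℕ) (h : Letter b → ℤ) (a : Letter b) :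
    (transition b ^ n *ᵥ h) a = ∑ w : Fin (n + 1) → Letter b,
      if w 0 = a then (∏ i : Fin n, transition b (w i.castSucc) (w i.succ)) * h (w (Fin.last n))
        else 0 := by
  induction n generalizing a with
  | zero =>
    rw [pow_zero, Matrix.one_mulVec, ← (Equiv.funUnique (Fin 1) (Letter b)).symm.sum_comp]
    simp [Equiv.funUnique]
  | succ n ih =>
    rw [pow_succ', ← Matrix.mulVec_mulVec, ← (Fin.consEquiv fun _ => Letter b).sum_comp,
      Fintype.sum_prod_type, Matrix.mulVec, dotProduct]
    simp only [ih, Fin.consEquiv_apply, Fin.cons_zero, Finset.mul_sum]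
    rw [Finset.sum_comm, Finset.sum_comm (s := Finset.univ (α := Letter b))]
    refine Finset.sum_congr rfl fun w _ => ?_
    simp only [mul_ite, mul_zero, Finset.sum_ite_eq, Finset.sum_ite_eq', Finset.mem_univ, if_true]
    rw [Fin.prod_univ_succ, mul_assoc]
    rfl

instance (N : ℕ) : Finite (CyclicWord b N) :=
  inferInstanceAs (Finite {a : Fin (N + 1) → Letter b //
    (∀ i : Fin N, Admissible (a i.castSucc) (a i.succ)) ∧ Admissible (a (Fin.last N)) (a 0)})

lemma card_cyclicWord_eq_trace (N : ℕ) :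
    (Nat.card (CyclicWord b N) : ℤ) = (transition b ^ (N + 1)).trace := by
  classical
  have h : ∀ a, (transition b ^ (N + 1)) a a =
      (transition b ^ N *ᵥ fun a' => transition b a' a) a := fun a => by
    rw [pow_succ, Matrix.mul_apply]
    rfl
  rw [Matrix.trace]
  simp only [Matrix.diag_apply, h, transition_pow_mulVec]
  rw [Finset.sum_comm]
  simp only [Finset.sum_ite_eq, Finset.mem_univ, if_true]
  have e : Nat.card (CyclicWord b N) = (Finset.univ.filter fun a : Fin (N + 1) → Letter b =>
      (∀ i : Fin N, Admissible (a i.castSucc) (a i.succ)) ∧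
        Admissible (a (Fin.last N)) (a 0)).card :=
    Nat.subtype_card _ (by simp)
  rw [e, Finset.card_filter]
  push_cast
  refine Finset.sum_congr rfl fun w _ => ?_
  simp only [transition, Matrix.of_apply]
  rw [Finset.prod_ite_zero]
  simp only [Finset.prod_const_one, Finset.mem_univ, true_imp_iff, ite_and, ite_mul, one_mul,
    zero_mul]

lemma card_cyclicWord (hg : 1 ≤ g) (N : ℕ) :
    Nat.card (CyclicWord b N) =
      if Even N then (2 * g - 1) ^ (N + 1) + 1 else (2 * g - 1) ^ (N + 1) + (2 * g - 1) := by
  have h := card_cyclicWord_eq_trace (b := b) N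
  rw [trace_transition_pow (by omega)] at h
  have hc : ((2 * g - 1 : ℕ) : ℤ) = 2 * g - 1 := by
    push_cast [Nat.cast_sub (show 1 ≤ 2 * g by omega)]; rfl
  rw [← hc] at h
  simp only [Nat.even_add_one] at h
  split_ifs with hN
  · rw [if_neg (not_not.2 hN)] at h; exact_mod_cast h
  · rw [if_pos hN] at h; exact_mod_cast h

/-! ### Periodic sequences and cyclically admissible words -/

lemma admissible_cyclic {N : ℕ} (a : CyclicWord b N) (i : Fin (N + 1)) :
    Admissible (a.1 i) (a.1 (i + 1)) := by
  induction i using Fin.lastCases with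
  | last => rw [Fin.last_add_one]; exact a.2.2
  | cast i => rw [Fin.coeSucc_eq_succ]; exact a.2.1 i

/-- The periodic sequence given by a cyclically admissible word. -/
def periodicSeq {N : ℕ} (a : CyclicWord b N) : Seq b :=
  -- `ZMod (N + 1)` unfolds to `Fin (N + 1)`, so residues serve as positions in the word.
  ⟨fun k => a.1 (k : ZMod (N + 1)), fun k => by
    have e : ((k + 1 : ℤ) : ZMod (N + 1)) = (k : ZMod (N + 1)) + 1 := by push_cast; rfl
    change Admissible (a.1 _) (a.1 ((k + 1 : ℤ) : ZMod (N + 1)))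
    rw [e]
    exact admissible_cyclic a _⟩

lemma periodicSeq_apply {N : ℕ} (a : CyclicWord b N) (k : ℤ) :
    (periodicSeq a).1 k = a.1 (k : ZMod (N + 1)) := rfl

lemma periodicSeq_coe {N : ℕ} (a : CyclicWord b N) (i : Fin (N + 1)) :
    (periodicSeq a).1 ((i : ℕ) : ℤ) = a.1 i := by
  rw [periodicSeq_apply, Int.cast_natCast]
  exact congrArg a.1 (ZMod.natCast_zmod_val (n := N + 1) i)

lemma translate_periodicSeq {N : ℕ} (a : CyclicWord b N) :
    translate (N + 1 : ℕ) (periodicSeq a) = periodicSeq a := by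
  ext k
  rw [translate_apply, periodicSeq_apply, periodicSeq_apply, Int.cast_add, Int.cast_natCast,
    ZMod.natCast_self, add_zero]

lemma apply_of_translate_eq {x : Seq b} {n : ℤ} (h : translate n x = x) (k : ℤ) :
    x.1 (k + n) = x.1 k := by
  conv_rhs => rw [← h]
  rfl

/-- The word of length `N + 1` of a sequence of period `N + 1`. -/
def periodWord (N : ℕ) (x : Seq b) (h : translate (N + 1 : ℕ) x = x) : CyclicWord b N :=
  ⟨fun i => x.1 ((i : ℕ) : ℤ), fun i => x.2 _, by
    have h0 := apply_of_translate_eq h 0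
    rw [zero_add, Nat.cast_add_one] at h0
    have := x.2 N
    rwa [h0] at this⟩

lemma periodicSeq_periodWord (N : ℕ) (x : Seq b) (h : translate (N + 1 : ℕ) x = x) :
    periodicSeq (periodWord N x h) = x := by
  ext k
  have e : (((k : ZMod (N + 1)).val : ℕ) : ℤ) = k % (N + 1 : ℕ) := ZMod.val_intCast k
  have := congrArg (fun y : Seq b => y.1 0) (translate_emod h k)
  simp only [translate_apply, zero_add] at this
  rw [← this, ← e]
  rfl

/-- Sequences of period `N + 1` correspond to cyclically admissible words. -/
def periodicEquiv (b : FreeGroupBasis (Fin g) Γ) (N : ℕ) :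
    {x : Seq b // translate (N + 1 : ℕ) x = x} ≃ CyclicWord b N where
  toFun x := periodWord N x.1 x.2
  invFun a := ⟨periodicSeq a, translate_periodicSeq a⟩
  left_inv x := Subtype.ext (periodicSeq_periodWord N x.1 x.2)
  right_inv a := Subtype.ext (funext fun i => periodicSeq_coe a i)

lemma finite_dvd {n : ℕ} (hn : 0 < n) : {x : Seq b | period x ∣ n}.Finite := by
  obtain ⟨N, rfl⟩ := Nat.exists_eq_add_one_of_ne_zero hn.ne'
  have : Finite {x : Seq b // translate (N + 1 : ℕ) x = x} :=
    Finite.of_equiv _ (periodicEquiv b N).symm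
  exact (Set.finite_coe_iff (s := {x : Seq b | translate (N + 1 : ℕ) x = x}).1 this).subset
    fun x hx => translate_eq_self_iff.2 hx

lemma finite_period {n : ℕ} (hn : 0 < n) : {x : Seq b | period x = n}.Finite :=
  (finite_dvd hn).subset fun _ hx => dvd_of_eq hx

/-- The number of points of minimal period `n`. -/
def numPoints (b : FreeGroupBasis (Fin g) Γ) (n : ℕ) : ℕ := Nat.card {x : Seq b // period x = n}

lemma sum_numPoints {n : ℕ} (hn : 0 < n) :
    ∑ d ∈ n.divisors, numPoints b d = Nat.card {x : Seq b // period x ∣ n} := by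
  classical
  have h1 : Nat.card {x : Seq b // period x ∣ n} = (finite_dvd (b := b) hn).toFinset.card :=
    Nat.subtype_card _ (by simp)
  rw [h1, Finset.card_eq_sum_card_fiberwise (f := period) (t := n.divisors)]
  · refine Finset.sum_congr rfl fun d hd => Nat.subtype_card _ fun x => ?_
    simp only [Finset.mem_filter, Set.Finite.mem_toFinset, Set.mem_ofPred_eq, and_iff_right_iff_imp]
    rintro rfl
    exact Nat.dvd_of_mem_divisors hd
  · intro x hx
    simp only [Finset.mem_coe, Set.Finite.mem_toFinset, Set.mem_ofPred_eq] at hx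
    simp [hx, hn.ne']

/-- The representatives of the orbits of minimal period `n`. -/
abbrev RepOfPeriod (b : FreeGroupBasis (Fin g) Γ) (n : ℕ) : Type :=
  {x : Rep b // period x.1 = n}

/-- Each point of minimal period `n` is `Tᵏ` of its representative for a unique `k < n`. -/
lemma card_repOfPeriod_mul {n : ℕ} (hn : 0 < n) :
    Nat.card (RepOfPeriod b n) * n = numPoints b n := by
  have e : Function.Bijective fun p : RepOfPeriod b n × Fin n =>
      (⟨translate (p.2 : ℕ) p.1.1.1, (period_translate _ _).trans p.1.2⟩ :
        {x : Seq b // period x = n}) := by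
    constructor
    · rintro ⟨⟨⟨x, hx⟩, hxn⟩, k⟩ ⟨⟨⟨y, hy⟩, hyn⟩, l⟩ h
      replace h : translate (k : ℕ) x = translate (l : ℕ) y := congrArg Subtype.val h
      have hr := congrArg rep h
      rw [rep_translate, rep_translate, hx.1, hy.1] at hr
      subst hr
      dsimp only at hxn
      rw [← shift_iterate, ← shift_iterate] at h
      have := Function.iterate_injOn_Iio_minimalPeriod (f := shift b) (x := x)
        (show (k : ℕ) < period x by rw [hxn]; exact k.2)
        (show (l : ℕ) < period x by rw [hxn]; exact l.2) h
      rw [Fin.ext this]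
    · rintro ⟨x, rfl⟩
      obtain ⟨m, hm⟩ := exists_translate_rep x
      have hp : translate (period x : ℕ) (rep x) = rep x :=
        translate_eq_self_iff.2 (dvd_of_eq (period_rep x))
      have hlt := Int.emod_lt_of_pos m (Int.natCast_pos.2 hn)
      have hnn := Int.emod_nonneg m (Int.natCast_pos.2 hn).ne'
      refine ⟨⟨⟨⟨rep x, rep_rep x, by rwa [period_rep]⟩, period_rep x⟩,
        ⟨(m % (period x : ℤ)).toNat, by omega⟩⟩, Subtype.ext ?_⟩
      dsimp only
      rw [Int.toNat_of_nonneg hnn, translate_emod hp, hm]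
  rw [numPoints, ← Nat.card_eq_of_bijective _ e, Nat.card_prod, Nat.card_fin]

instance (n : ℕ) : Finite (RepOfPeriod b n) := by
  rcases Nat.eq_zero_or_pos n with rfl | hn
  · have : IsEmpty (RepOfPeriod b 0) := ⟨fun x => x.1.2.2.ne' x.2⟩
    infer_instance
  · have := (finite_period (b := b) hn).to_subtype
    exact Finite.of_injective
      (fun x : RepOfPeriod b n => (⟨x.1.1, x.2⟩ : {x : Seq b | period x = n}))
      fun x y h => Subtype.ext (Subtype.ext (congrArg (fun z => z.1) h))

/-- The sequence which has the letter `c` at the multiples of `n` and the letter `a` elsewhere. -/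
lemma exists_period (hg : 2 ≤ g) (n : ℕ) : ∃ x : Seq b, period x = n := by
  classical
  let i : Fin g := ⟨0, by omega⟩
  let j : Fin g := ⟨1, by omega⟩
  have hij : j ≠ i := by simp [i, j]
  -- Only generators occur, no inverses, so nothing cancels. For `n = 0` the letter `b i` occurs
  -- once and the sequence is not periodic.
  let x : Seq b := ⟨fun k => letterEquiv b (Sum.inl (if (n : ℤ) ∣ k then i else j)),
    fun k => basis_ne_inv _ _⟩
  have hx : ∀ m : ℕ, translate m x = x ↔ n ∣ m := fun m => by
    constructor
    · intro h
      have := (letterEquiv b).injective (apply_of_translate_eq h 0)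
      by_contra hm
      simp [Int.natCast_dvd_natCast, hm, hij] at this
    · intro h
      ext k
      change (letterEquiv b) (Sum.inl (if (n : ℤ) ∣ k + m then i else j)) =
        (letterEquiv b) (Sum.inl (if (n : ℤ) ∣ k then i else j))
      simp only [Int.dvd_add_left (Int.natCast_dvd_natCast.2 h)]
  refine ⟨x, Nat.dvd_antisymm ?_ ?_⟩
  · exact translate_eq_self_iff.1 ((hx n).2 dvd_rfl)
  · exact (hx _).1 (translate_eq_self_iff.2 dvd_rfl)

lemma card_repOfPeriod_pos (hg : 2 ≤ g) {n : ℕ} (hn : 0 < n) : 0 < Nat.card (RepOfPeriod b n) := by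
  obtain ⟨x, hx⟩ := exists_period (b := b) hg n
  have : Nonempty (RepOfPeriod b n) :=
    ⟨⟨⟨rep x, rep_rep x, by rw [period_rep]; omega⟩, (period_rep x).trans hx⟩⟩
  exact Nat.card_pos

/-! ### The number of orbits -/

/-- The correction to the number of points of minimal period `n`. -/
def correction (g n : ℕ) : ℚ := if n = 1 then 1 else if n = 2 then 2 * g - 2 else 0

/-- The parity-dependent term in the number of fixed points of `Tⁿ` is itself a divisor sum,
supported at `d = 1` and `d = 2`. After subtracting it, Möbius inversion applies to the pure power
`(2g - 1)ⁿ`. -/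
lemma sum_correction (g : ℕ) {n : ℕ} (hn : 0 < n) :
    ∑ d ∈ n.divisors, correction g d = if Even n then 2 * (g : ℚ) - 1 else 1 := by
  have h : ∀ d, correction g d =
      (if d = 1 then 1 else 0) + (if d = 2 then 2 * (g : ℚ) - 2 else 0) := fun d => by
    unfold correction
    split_ifs <;> first | omega | simp
  simp only [h, Finset.sum_add_distrib, Finset.sum_ite_eq', Nat.mem_divisors, one_dvd, hn.ne',
    even_iff_two_dvd, ne_eq, not_false_eq_true, and_true, if_true]
  split_ifs <;> ring

lemma numPoints_eq (hg : 1 ≤ g) {n : ℕ} (hn : 0 < n) :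
    (numPoints b n : ℚ) = (∑ d ∈ n.divisors,
      (ArithmeticFunction.moebius d : ℚ) * (2 * (g : ℚ) - 1) ^ (n / d)) + correction g n := by
  have h1 : ∀ n > 0, ∑ d ∈ n.divisors, ((numPoints b d : ℚ) - correction g d) =
      (2 * (g : ℚ) - 1) ^ n := fun n hn => by
    rw [Finset.sum_sub_distrib, sum_correction g hn, ← Nat.cast_sum, sum_numPoints hn]
    obtain ⟨N, rfl⟩ := Nat.exists_eq_add_one_of_ne_zero hn.ne'
    have e : Nat.card {x : Seq b // period x ∣ N + 1} = Nat.card (CyclicWord b N) := by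
      rw [← Nat.card_congr (periodicEquiv b N)]
      exact Nat.card_congr (Equiv.subtypeEquivRight fun x => translate_eq_self_iff.symm)
    have hc : ((2 * g - 1 : ℕ) : ℚ) = 2 * g - 1 := by
      push_cast [Nat.cast_sub (show 1 ≤ 2 * g by omega)]; rfl
    rw [e, card_cyclicWord hg, ← hc]
    simp only [Nat.even_add_one]
    split_ifs <;> first | contradiction | (push_cast; ring)
  have h2 := ArithmeticFunction.sum_eq_iff_sum_mul_moebius_eq.1 h1 n hn
  rw [Nat.sum_divisorsAntidiagonal
    (f := fun d e => (ArithmeticFunction.moebius d : ℚ) * (2 * (g : ℚ) - 1) ^ e)] at h2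
  rw [h2]
  ring

lemma card_repOfPeriod_eq (hg : 1 ≤ g) {n : ℕ} (hn : 0 < n) :
    (Nat.card (RepOfPeriod b n) : ℚ) = 1 / (n : ℚ) * ((∑ d ∈ n.divisors,
      (ArithmeticFunction.moebius d : ℚ) * (2 * (g : ℚ) - 1) ^ (n / d)) + correction g n) := by
  rw [← numPoints_eq (b := b) hg hn, ← card_repOfPeriod_mul hn]
  have : (n : ℚ) ≠ 0 := by positivity
  push_cast
  field_simp

lemma sum_moebius_two (q : ℚ) :
    ∑ d ∈ Nat.divisors 2, (ArithmeticFunction.moebius d : ℚ) * q ^ (2 / d) = q ^ 2 - q := by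
  rw [Nat.Prime.sum_divisors Nat.prime_two, ArithmeticFunction.moebius_apply_prime Nat.prime_two]
  simp
  ring

lemma card_repOfPeriod_one (hg : 1 ≤ g) : Nat.card (RepOfPeriod b 1) = 2 * g := by
  have := card_repOfPeriod_eq (b := b) hg one_pos
  simp [correction] at this
  exact_mod_cast this

lemma card_repOfPeriod_two (hg : 1 ≤ g) : Nat.card (RepOfPeriod b 2) = 2 * g * (g - 1) := by
  have := card_repOfPeriod_eq (b := b) hg two_pos
  rw [sum_moebius_two, correction, if_neg (by norm_num), if_pos rfl] at this
  obtain ⟨k, rfl⟩ := Nat.exists_eq_add_of_le hg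
  rw [Nat.add_sub_cancel_left]
  have h : (Nat.card (RepOfPeriod b 2) : ℚ) = ((2 * (1 + k) * k : ℕ) : ℚ) := by
    rw [this]
    push_cast
    ring
  exact_mod_cast h

/-! ### Submodules spanned by parts of a basis -/

section Spans

variable {ι M : Type*} [AddCommGroup M] {hM : Module ℤ M}

lemma isInternal_span_fibers (v : Module.Basis ι ℤ M) (c : ι → ℕ) :
    DirectSum.IsInternal fun N => Submodule.span ℤ (v '' {i | c i = N}) := by
  rw [DirectSum.isInternal_submodule_iff_iSupIndep_and_iSup_eq_top]
  constructor
  · intro N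
    have h : ⨆ (j) (_ : j ≠ N), Submodule.span ℤ (v '' {i | c i = j}) ≤
        Submodule.span ℤ (v '' {i | c i ≠ N}) :=
      iSup₂_le fun j hj => Submodule.span_mono
        (Set.image_mono fun i (hi : c i = j) => show c i ≠ N from hi ▸ hj)
    refine (v.linearIndependent.disjoint_span_image ?_).mono_right h
    exact Set.disjoint_left.2 fun i hi hi' => hi' hi
  · rw [eq_top_iff, ← v.span_eq, Submodule.span_le]
    rintro _ ⟨i, rfl⟩
    exact Submodule.mem_iSup_of_mem (c i) (Submodule.subset_span ⟨i, rfl, rfl⟩)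

/-- Freeness and rank do not depend on the instance of the `ℤ`-module structure. -/
lemma free_finite_finrank_of_basis {ι M : Type*} [AddCommGroup M] {hM hM' : Module ℤ M}
    (v : @Module.Basis ι ℤ M _ _ hM) [Finite ι] :
    @Module.Free ℤ M _ _ hM' ∧ @Module.Finite ℤ M _ _ hM' ∧
      @Module.finrank ℤ M _ _ hM' = Nat.card ι := by
  obtain rfl : hM = hM' := Subsingleton.elim _ _
  exact ⟨Module.Free.of_basis v, Module.Finite.of_basis v, Module.finrank_eq_nat_card_basis v⟩

lemma free_finite_finrank_span_image (v : Module.Basis ι ℤ M) (s : Set ι) [Finite s] :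
    Module.Free ℤ (Submodule.span ℤ (v '' s)) ∧ Module.Finite ℤ (Submodule.span ℤ (v '' s)) ∧
      Module.finrank ℤ (Submodule.span ℤ (v '' s)) = Nat.card s := by
  have e : Submodule.span ℤ (Set.range (v ∘ Subtype.val : s → M)) =
      Submodule.span ℤ (v '' s) := by rw [Set.range_comp, Subtype.range_coe]
  rw [← e]
  exact free_finite_finrank_of_basis (Module.Basis.span (v.linearIndependent.comp
    (Subtype.val : s → ι) Subtype.val_injective))

/-- Spans of initial segments of a basis realise any monotone unbounded sequence of ranks. -/
lemma exists_filtration (v : Module.Basis ℕ ℤ M) {r : ℕ → ℕ} (hr : Monotone r)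
    (hr' : ∀ n, ∃ N, n < r N) :
    ∃ F : ℕ → Submodule ℤ M, Monotone F ∧ (⨆ N, F N) = ⊤ ∧
      ∀ N, Module.Free ℤ (F N) ∧ Module.Finite ℤ (F N) ∧ Module.finrank ℤ (F N) = r N := by
  refine ⟨fun N => Submodule.span ℤ (v '' Set.Iio (r N)), fun N N' h =>
    Submodule.span_mono (Set.image_mono (Set.Iio_subset_Iio (hr h))), ?_, fun N => ?_⟩
  · rw [eq_top_iff, ← v.span_eq, Submodule.span_le]
    rintro _ ⟨i, rfl⟩
    obtain ⟨N, hN⟩ := hr' i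
    exact Submodule.mem_iSup_of_mem N (Submodule.subset_span ⟨i, hN, rfl⟩)
  · have := free_finite_finrank_span_image v (Set.Iio (r N))
    rwa [Nat.card_eq_fintype_card, Fintype.card_Iio, Nat.card_Iio] at this

/-- Regrouping a countable basis into blocks realises any sequence of finite ranks with infinite
total. -/
lemma exists_decomposition (v : Module.Basis ℕ ℤ M) (r : ℕ → ℕ) [Infinite (Σ N, Fin (r N))] :
    ∃ S : ℕ → Submodule ℤ M, DirectSum.IsInternal S ∧
      ∀ N, Module.Free ℤ (S N) ∧ Module.Finite ℤ (S N) ∧ Module.finrank ℤ (S N) = r N := by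
  obtain ⟨e⟩ := nonempty_equiv_of_countable (α := ℕ) (β := Σ N, Fin (r N))
  refine ⟨_, isInternal_span_fibers (v.reindex e) Sigma.fst, fun N => ?_⟩
  let e' : {p : Σ N, Fin (r N) | p.1 = N} ≃ Fin (r N) := Equiv.sigmaSubtype N
  have : Finite {p : Σ N, Fin (r N) | p.1 = N} := Finite.of_equiv _ e'.symm
  have h := free_finite_finrank_span_image (v.reindex e) {p : Σ N, Fin (r N) | p.1 = N}
  rwa [Nat.card_congr e', Nat.card_fin] at h

end Spans

/-! ### The direct limit of the groups of words -/

lemma period_periodicSeq_dvd {N : ℕ} (a : CyclicWord b N) : period (periodicSeq a) ∣ N + 1 :=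
  translate_eq_self_iff.1 (translate_periodicSeq a)

/-- The homomorphism which sends a word to the closed orbit which it encodes. -/
def wordClass (b : FreeGroupBasis (Fin g) Γ) (N : ℕ) : K b N →ₗ[ℤ] H1 b :=
  Finsupp.linearCombination ℤ fun a => orbitClass b (periodicSeq a)

lemma wordClass_single {N : ℕ} (a : CyclicWord b N) :
    wordClass b N (Finsupp.single a 1) = orbitClass b (periodicSeq a) := by
  rw [wordClass, Finsupp.linearCombination_single]
  exact (int_smul_eq_zsmul _ _ _).trans (one_zsmul _)

open Classical in
/-- The homomorphism which sends the closed orbits whose length divides `N + 1` to a word of length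
`N + 1` which encodes them, and the other closed orbits to `0`. -/
def chooseWord (b : FreeGroupBasis (Fin g) Γ) (N : ℕ) : H1 b →ₗ[ℤ] K b N :=
  (orbitBasis b).constr ℤ fun x =>
    if h : translate (N + 1 : ℕ) x.1 = x.1 then Finsupp.single (periodWord N x.1 h) 1 else 0

lemma wordClass_chooseWord_orbitClass {N : ℕ} {x : Seq b} (h : period x ∣ N + 1) :
    wordClass b N (chooseWord b N (orbitClass b x)) = orbitClass b x := by
  let y : Rep b := ⟨rep x, rep_rep x, by
    rw [period_rep]; exact Nat.pos_of_dvd_of_pos h (Nat.succ_pos N)⟩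
  have hy : translate (N + 1 : ℕ) y.1 = y.1 := translate_eq_self_iff.2 (by rwa [period_rep])
  rw [← orbitClass_rep, ← orbitBasis_apply y, chooseWord, Module.Basis.constr_basis, dif_pos hy,
    wordClass_single, periodicSeq_periodWord, orbitBasis_apply]

/-- Orbits encoded by words of length `M + 1` have period dividing `N + 1`, and on these
`chooseWord` is a section of `wordClass`. -/
lemma wordClass_chooseWord_wordClass {M N : ℕ} (h : M + 1 ∣ N + 1) (f : K b M) :
    wordClass b N (chooseWord b N (wordClass b M f)) = wordClass b M f := by
  have : wordClass b N ∘ₗ chooseWord b N ∘ₗ wordClass b M = wordClass b M := by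
    refine Finsupp.lhom_ext' fun a => LinearMap.ext_ring ?_
    simp only [LinearMap.comp_apply, Finsupp.lsingle_apply, wordClass_single]
    exact wordClass_chooseWord_orbitClass ((period_periodicSeq_dvd a).trans h)
  exact LinearMap.congr_fun this f

/-- The transition maps: a word is sent to a word which encodes the same closed orbit. -/
def wordMap (b : FreeGroupBasis (Fin g) Γ) (i j : WordIndex) (_ : i ≤ j) :
    K b i.val →ₗ[ℤ] K b j.val :=
  -- The case `i = j` is separate because `chooseWord ∘ₗ wordClass` is not the identity: it replaces
  -- a word by a chosen rotation.
  if e : i = j then e ▸ LinearMap.id else chooseWord b j.val ∘ₗ wordClass b i.val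

lemma wordMap_self {i : WordIndex} (f : K b i.val) : wordMap b i i le_rfl f = f := by
  rw [wordMap, dif_pos rfl]
  rfl

lemma wordMap_of_ne {i j : WordIndex} (h : i ≤ j) (hij : i ≠ j) (f : K b i.val) :
    wordMap b i j h f = chooseWord b j.val (wordClass b i.val f) := by
  rw [wordMap, dif_neg hij]
  rfl

lemma wordClass_wordMap {i j : WordIndex} (h : i ≤ j) (f : K b i.val) :
    wordClass b j.val (wordMap b i j h f) = wordClass b i.val f := by
  by_cases hij : i = j
  · subst hij
    rw [wordMap_self]
  · rw [wordMap_of_ne h hij]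
    exact wordClass_chooseWord_wordClass h f

lemma WordIndex.le_antisymm' {i j : WordIndex} (h : i ≤ j) (h' : j ≤ i) : i = j := by
  have := Nat.dvd_antisymm h h'
  cases i; cases j
  simpa using this

instance directedSystem_wordMap : DirectedSystem (fun i : WordIndex => K b i.val)
    (fun i j h => wordMap b i j h) where
  map_self i f := wordMap_self f
  map_map k j i hij hjk f := by
    by_cases h1 : i = j
    · subst h1
      rw [wordMap_self]
    by_cases h2 : j = k
    · subst h2
      rw [wordMap_self]
    -- Antisymmetry of divisibility ensures that two proper transitions never compose to the index
    -- one started from.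
    have h3 : i ≠ k := by
      rintro rfl
      exact h1 (WordIndex.le_antisymm' hij hjk)
    rw [wordMap_of_ne hjk h2, wordClass_wordMap, wordMap_of_ne _ h3]

instance : Nonempty WordIndex := ⟨⟨0⟩⟩

instance : IsDirectedOrder WordIndex where
  directed i j := ⟨⟨(i.val + 1) * (j.val + 1) - 1⟩, by
    have e : (i.val + 1) * (j.val + 1) - 1 + 1 = (i.val + 1) * (j.val + 1) :=
      Nat.sub_add_cancel (Nat.mul_pos (Nat.succ_pos _) (Nat.succ_pos _))
    exact ⟨(Nat.dvd_mul_right _ _).trans (dvd_of_eq e.symm),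
      (Nat.dvd_mul_left _ _).trans (dvd_of_eq e.symm)⟩⟩

/-- The homomorphism from the direct limit of the groups of words to the homology of the mapping
torus. -/
def limitMap (b : FreeGroupBasis (Fin g) Γ) :
    Module.DirectLimit (fun i : WordIndex => K b i.val) (wordMap b) →ₗ[ℤ] H1 b :=
  Module.DirectLimit.lift ℤ WordIndex _ (wordMap b) (fun i => wordClass b i.val)
    fun _ _ h f => wordClass_wordMap h f

lemma limitMap_of (i : WordIndex) (f : K b i.val) :
    limitMap b (Module.DirectLimit.of ℤ WordIndex (fun i : WordIndex => K b i.val)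
      (wordMap b) i f) = wordClass b i.val f :=
  Module.DirectLimit.lift_of _ _ _

lemma limitMap_injective : Function.Injective (limitMap b) := by
  rw [injective_iff_map_eq_zero]
  intro z hz
  obtain ⟨i, f, rfl⟩ := Module.DirectLimit.exists_of z
  rw [limitMap_of] at hz
  -- Doubling the word length gives a strictly larger index, and the transition to it already kills
  -- the kernel of `wordClass`.
  let j : WordIndex := ⟨2 * i.val + 1⟩
  have hij : i ≤ j := ⟨2, by simp only [j]; ring⟩
  have hne : i ≠ j := fun h => by
    have := congrArg WordIndex.val h
    simp only [j] at this
    omega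
  rw [← Module.DirectLimit.of_f (hij := hij), wordMap_of_ne hij hne, hz, map_zero, map_zero]

lemma limitMap_surjective : Function.Surjective (limitMap b) := by
  rw [← LinearMap.range_eq_top, eq_top_iff, ← (orbitBasis b).span_eq, Submodule.span_le]
  rintro _ ⟨x, rfl⟩
  obtain ⟨N, hN⟩ := Nat.exists_eq_add_one_of_ne_zero x.2.2.ne'
  have hx : translate (N + 1 : ℕ) x.1 = x.1 := translate_eq_self_iff.2 (dvd_of_eq hN)
  refine ⟨Module.DirectLimit.of ℤ WordIndex (fun i : WordIndex => K b i.val) (wordMap b) ⟨N⟩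
    (Finsupp.single (periodWord N x.1 hx) 1), ?_⟩
  rw [limitMap_of, wordClass_single, periodicSeq_periodWord, orbitBasis_apply]

/-! ### Ranks -/

lemma finite_K (b : FreeGroupBasis (Fin g) Γ) (N : ℕ) : Module.Finite ℤ (K b N) := inferInstance

lemma finrank_K (hg : 1 ≤ g) (N : ℕ) : Module.finrank ℤ (K b N) =
    if Even N then (2 * g - 1) ^ (N + 1) + 1 else (2 * g - 1) ^ (N + 1) + (2 * g - 1) := by
  rw [← card_cyclicWord (b := b) hg]
  exact Module.finrank_eq_nat_card_basis Finsupp.basisSingleOne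

lemma monotone_rank {q : ℕ} (hq : 2 ≤ q) :
    Monotone fun N => if Even N then q ^ N + 1 else q ^ N + q := by
  refine monotone_nat_of_le_succ fun N => ?_
  simp only [Nat.even_add_one]
  have h1 : q ^ N * 2 ≤ q ^ (N + 1) := Nat.mul_le_mul_left _ hq
  have h2 : 1 ≤ q ^ N := Nat.one_le_pow _ _ (by omega)
  split_ifs with h
  · omega
  · have h3 : q ≤ q ^ N := Nat.le_self_pow (by rintro rfl; simp at h) q
    omega

lemma lt_rank {q : ℕ} (hq : 2 ≤ q) (N : ℕ) : N < if Even N then q ^ N + 1 else q ^ N + q := by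
  have := Nat.lt_pow_self (n := N) (show 1 < q by omega)
  split_ifs <;> omega

lemma monotone_finrank_K (hg : 2 ≤ g) : Monotone fun N => Module.finrank ℤ (K b N) := by
  have hq : 3 ≤ 2 * g - 1 := by omega
  generalize hqd : 2 * g - 1 = q at hq
  refine monotone_nat_of_le_succ fun N => ?_
  simp only [finrank_K (show 1 ≤ g by omega), Nat.even_add_one, hqd]
  have h1 : q ^ (N + 1) * 2 ≤ q ^ (N + 1 + 1) := Nat.mul_le_mul_left _ (by omega)
  have h3 : q ≤ q ^ (N + 1) := Nat.le_self_pow (by omega) q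
  split_ifs <;> first | contradiction | omega

lemma lt_finrank_K (hg : 2 ≤ g) (N : ℕ) : N < Module.finrank ℤ (K b N) := by
  rw [finrank_K (by omega)]
  have := Nat.lt_pow_self (n := N + 1) (show 1 < 2 * g - 1 by omega)
  split_ifs <;> omega

lemma infinite_sigma_of_pos {r : ℕ → ℕ} (h : ∀ N, 2 < N → 0 < r N) : Infinite (Σ N, Fin (r N)) :=
  Infinite.of_injective (fun N : ℕ => (⟨N + 3, 0, h _ (by omega)⟩ : Σ N, Fin (r N)))
    fun M N hMN => by
      have : M + 3 = N + 3 := congrArg Sigma.fst hMN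
      omega

/-- For each positive period the closed orbits are finite in number, and at least one exists; hence
`Rep b` is countably infinite. -/
lemma exists_basis_nat (hg : 2 ≤ g) : Nonempty (Module.Basis ℕ ℤ (H1 b)) := by
  let e : Rep b ≃ Σ N, RepOfPeriod b N := (Equiv.sigmaFiberEquiv fun x : Rep b => period x.1).symm
  have hc : Countable (Rep b) := Countable.of_equiv _ e.symm
  have hi : Infinite (Σ N, RepOfPeriod b N) := by
    have hne : ∀ N, Nonempty (RepOfPeriod b (N + 1)) := fun N =>
      (Nat.card_pos_iff.1 (card_repOfPeriod_pos hg (Nat.succ_pos N))).1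
    refine Infinite.of_injective
      (fun N : ℕ => (⟨N + 1, (hne N).some⟩ : Σ N, RepOfPeriod b N)) fun M N hMN => ?_
    have : M + 1 = N + 1 := congrArg Sigma.fst hMN
    omega
  have hi' : Infinite (Rep b) := Infinite.of_injective e.symm e.symm.injective
  obtain ⟨f⟩ := nonempty_equiv_of_countable (α := Rep b) (β := ℕ)
  exact ⟨(orbitBasis b).reindex f⟩

lemma free_finite_finrank_R (N : ℕ) : Module.Free ℤ (R b N) ∧ Module.Finite ℤ (R b N) ∧
    Module.finrank ℤ (R b N) = Nat.card (RepOfPeriod b N) := by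
  rw [R_eq_span]
  have : Finite {x : Rep b | period x.1 = N} := inferInstanceAs (Finite (RepOfPeriod b N))
  exact free_finite_finrank_span_image (orbitBasis b) {x | period x.1 = N}

lemma isInternal_R : DirectSum.IsInternal (R b) := by
  have h : R b = fun N => Submodule.span ℤ (orbitBasis b '' {x | period x.1 = N}) :=
    funext fun N => R_eq_span
  rw [h]
  exact isInternal_span_fibers (orbitBasis b) fun x => period x.1

lemma R_zero : R b 0 = ⊥ := by
  rw [R_eq_span, Submodule.span_eq_bot]
  rintro _ ⟨x, hx, rfl⟩
  exact absurd hx x.2.2.ne'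

/-- The number of closed orbits of length `N`, with a correction for `N = 2`. -/
def modifiedRank (b : FreeGroupBasis (Fin g) Γ) (N : ℕ) : ℕ :=
  -- This is `((2g - 1)² - (2g - 1)) / 2`, the Möbius formula at `N = 2`; it is `g - 1` less than
  -- the number of orbits of period 2.
  if N = 2 then (2 * g - 1) * (g - 1) else Nat.card (RepOfPeriod b N)

lemma modifiedRank_eq (hg : 1 ≤ g) {N : ℕ} (hN : 1 < N) :
    (modifiedRank b N : ℚ) = 1 / (N : ℚ) * ∑ d ∈ N.divisors,
      (ArithmeticFunction.moebius d : ℚ) * (2 * (g : ℚ) - 1) ^ (N / d) := by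
  rw [modifiedRank]
  split_ifs with h
  · subst h
    rw [sum_moebius_two]
    obtain ⟨k, rfl⟩ := Nat.exists_eq_add_of_le hg
    have : 2 * (1 + k) - 1 = 2 * k + 1 := by omega
    rw [this, Nat.add_sub_cancel_left]
    push_cast
    ring
  · rw [card_repOfPeriod_eq hg (by omega), correction, if_neg (by omega), if_neg h, add_zero]

end SchottkyShift

end

theorem mainTheorem5 (g : ℕ) (hg : 2 ≤ g) {Γ : Type} [Group Γ]
    (b : FreeGroupBasis (Fin g) Γ) :
    -- the ranks of the free abelian groups on the cyclically admissible words
    (∀ N : ℕ, Module.Finite ℤ (SchottkyShift.K b N) ∧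
      Module.finrank ℤ (SchottkyShift.K b N) =
        if Even N then (2 * g - 1) ^ (N + 1) + 1 else (2 * g - 1) ^ (N + 1) + (2 * g - 1)) ∧
    -- `H₁` is their direct limit, a word being mapped to the closed orbit which it encodes
    (∃ (f : ∀ i j : SchottkyShift.WordIndex, i ≤ j →
          (SchottkyShift.K b i.val →ₗ[ℤ] SchottkyShift.K b j.val))
        (_ : DirectedSystem (fun i : SchottkyShift.WordIndex => SchottkyShift.K b i.val)
          (fun i j h => f i j h))
        (φ : Module.DirectLimit (fun i : SchottkyShift.WordIndex => SchottkyShift.K b i.val) f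
          ≃ₗ[ℤ] SchottkyShift.H1 b),
      ∀ (N : ℕ) (a : SchottkyShift.CyclicWord b N), ∃ x : SchottkyShift.Seq b,
        (∀ k : ℤ, x.1 (k + (N + 1)) = x.1 k) ∧
        (∀ i : Fin (N + 1), x.1 ((i : ℕ) : ℤ) = a.1 i) ∧
        φ (Module.DirectLimit.of ℤ SchottkyShift.WordIndex
            (fun i : SchottkyShift.WordIndex => SchottkyShift.K b i.val) f ⟨N⟩
            (Finsupp.single a (1 : ℤ))) =
          SchottkyShift.orbitClass b x) ∧
    -- `H₁` is an increasing union of subgroups isomorphic to these free abelian groups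
    (∃ F : ℕ → Submodule ℤ (SchottkyShift.H1 b), Monotone F ∧ (⨆ N, F N) = ⊤ ∧
      ∀ N, Nonempty (SchottkyShift.K b N ≃ₗ[ℤ] F N)) ∧
    -- `H₁` is an increasing union of free subgroups whose ranks have the exponent `N`
    (∃ F : ℕ → Submodule ℤ (SchottkyShift.H1 b), Monotone F ∧ (⨆ N, F N) = ⊤ ∧
      ∀ N, Module.Free ℤ (F N) ∧ Module.Finite ℤ (F N) ∧
        Module.finrank ℤ (F N) =
          if Even N then (2 * g - 1) ^ N + 1 else (2 * g - 1) ^ N + (2 * g - 1)) ∧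
    -- `H₁` is the direct sum of the groups generated by the closed orbits of minimal period `N`
    (DirectSum.IsInternal (SchottkyShift.R b) ∧ SchottkyShift.R b 0 = ⊥ ∧
      (∀ N, Module.Free ℤ (SchottkyShift.R b N) ∧ Module.Finite ℤ (SchottkyShift.R b N)) ∧
      Module.finrank ℤ (SchottkyShift.R b 1) = 2 * g ∧
      Module.finrank ℤ (SchottkyShift.R b 2) = 2 * g * (g - 1) ∧
      ∀ N, 2 < N → (Module.finrank ℤ (SchottkyShift.R b N) : ℚ) =
        1 / (N : ℚ) * ∑ d ∈ N.divisors,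
          (ArithmeticFunction.moebius d : ℚ) * (2 * (g : ℚ) - 1) ^ (N / d)) ∧
    -- `H₁` is a direct sum of free groups whose ranks are given by the formula for all `N > 1`
    (∃ R' : ℕ → Submodule ℤ (SchottkyShift.H1 b), DirectSum.IsInternal R' ∧ R' 0 = ⊥ ∧
      (∀ N, Module.Free ℤ (R' N) ∧ Module.Finite ℤ (R' N)) ∧
      Module.finrank ℤ (R' 1) = 2 * g ∧
      ∀ N, 1 < N → (Module.finrank ℤ (R' N) : ℚ) =
        1 / (N : ℚ) * ∑ d ∈ N.divisors,
          (ArithmeticFunction.moebius d : ℚ) * (2 * (g : ℚ) - 1) ^ (N / d)) ∧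
    -- `H₁` is free abelian on countably infinitely many generators
    Nonempty (Module.Basis ℕ ℤ (SchottkyShift.H1 b)) := by
  obtain ⟨v⟩ := SchottkyShift.exists_basis_nat (b := b) hg
  have hg1 : 1 ≤ g := by omega
  have hq : 2 ≤ 2 * g - 1 := by omega
  refine ⟨fun N => ⟨SchottkyShift.finite_K b N, SchottkyShift.finrank_K hg1 N⟩, ?_, ?_, ?_, ?_, ?_,
    ⟨v⟩⟩
  · refine ⟨SchottkyShift.wordMap b, SchottkyShift.directedSystem_wordMap,
      LinearEquiv.ofBijective (SchottkyShift.limitMap b)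
        ⟨SchottkyShift.limitMap_injective, SchottkyShift.limitMap_surjective⟩, fun N a => ?_⟩
    refine ⟨SchottkyShift.periodicSeq a, fun k => ?_, fun i => SchottkyShift.periodicSeq_coe a i,
      ?_⟩
    · have := SchottkyShift.apply_of_translate_eq (SchottkyShift.translate_periodicSeq a) k
      rwa [Nat.cast_add_one] at this
    · exact (SchottkyShift.limitMap_of ⟨N⟩ _).trans (SchottkyShift.wordClass_single a)
  · obtain ⟨F, hF, hF', h⟩ := SchottkyShift.exists_filtration v
      (SchottkyShift.monotone_finrank_K (b := b) hg)
      fun N => ⟨N, SchottkyShift.lt_finrank_K hg N⟩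
    refine ⟨F, hF, hF', fun N => ?_⟩
    obtain ⟨h1, h2, h3⟩ := h N
    -- The isomorphism is abstract, from equality of ranks: the map `wordClass` itself need not be
    -- injective.
    exact ⟨LinearEquiv.ofFinrankEq _ _ h3.symm⟩
  · exact SchottkyShift.exists_filtration v (SchottkyShift.monotone_rank hq)
      fun N => ⟨N, SchottkyShift.lt_rank hq N⟩
  · refine ⟨SchottkyShift.isInternal_R, SchottkyShift.R_zero, fun N =>
      ⟨(SchottkyShift.free_finite_finrank_R N).1, (SchottkyShift.free_finite_finrank_R N).2.1⟩,
      ?_, ?_, fun N hN => ?_⟩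
    · rw [(SchottkyShift.free_finite_finrank_R 1).2.2, SchottkyShift.card_repOfPeriod_one hg1]
    · rw [(SchottkyShift.free_finite_finrank_R 2).2.2, SchottkyShift.card_repOfPeriod_two hg1]
    · rw [(SchottkyShift.free_finite_finrank_R N).2.2, ← SchottkyShift.modifiedRank_eq (b := b) hg1
        (by omega), SchottkyShift.modifiedRank, if_neg (by omega)]
  · have hpos : ∀ N, 2 < N → 0 < SchottkyShift.modifiedRank b N := fun N hN => by
      rw [SchottkyShift.modifiedRank, if_neg (by omega)]
      exact SchottkyShift.card_repOfPeriod_pos hg (by omega)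
    have := SchottkyShift.infinite_sigma_of_pos hpos
    obtain ⟨S, hS, h⟩ := SchottkyShift.exists_decomposition v (SchottkyShift.modifiedRank b)
    refine ⟨S, hS, ?_, fun N => ⟨(h N).1, (h N).2.1⟩, ?_, fun N hN => ?_⟩
    -- No orbit in `Rep` has period 0, so the block with index 0 has rank 0.
    · obtain ⟨h1, h2, h3⟩ := h 0
      rw [SchottkyShift.modifiedRank, if_neg (by omega),
        ← (SchottkyShift.free_finite_finrank_R 0).2.2, SchottkyShift.R_zero] at h3
      rw [Module.finrank_zero_of_subsingleton (M := (⊥ : Submodule ℤ (SchottkyShift.H1 b)))] at h3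
      exact Submodule.subsingleton_iff_eq_bot.1 (Module.finrank_zero_iff.1 h3)
    · rw [(h 1).2.2, SchottkyShift.modifiedRank, if_neg (by omega),
        SchottkyShift.card_repOfPeriod_one hg1]
    · rw [(h N).2.2, SchottkyShift.modifiedRank_eq hg1 hN]
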